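/- **Setting.** A base station is at the origin of $\mathbb{R}^2$. There are $M$ legitimate users, at independent positions uniform in the disc of radius $R_D>0$ about the origin. A user at distance $d$ with fading coefficient $\tilde g\sim\mathcal{CN}(0,1)$ has channel gain $|\tilde g|^2/(1+d^\alpha)$, $\alpha>0$. Let $|h_1|^2\le\dots\le|h_M|^2$ be the ordered gains; fix $1\le n\le M$ and let $\gamma_{B_n}=\rho_b a_n|h_n|^2$, where $\rho_b,a_n>0$. Eavesdroppers form a homogeneous Poisson point process $\Phi_e$ on $\mathbb{R}^2$ with density $\lambda_e>0$; eavesdropper $e$, at distance $d_e$ from the origin, has fading coefficient $g_e\sim\mathcal{CN}(0,1)$. For $r_p,\rho_e>0$ let $$\gamma_{E_n}=\rho_e a_n\sup_{e\in\Phi_e,\ d_e\ge r_p}|g_e|^2d_e^{-\alpha}.$$ All positions and fading coefficients are independent. For a target secrecy rate $R_n>0$ the secrecy outage probability of the $n$-th user is $$\mathrm{SOP}_n(R_n)=\Pr\left\{\left[\log_2(1+\gamma_{B_n})-\log_2(1+\gamma_{E_n})\right]^+<R_n\right\}.$$ **Notation.** $\delta=2/\alpha$, $\Gamma(s,x)=\int_x^\infty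 t^{s-1}e^{-t}\,dt$, $\mu_{n1}=\delta\pi\lambda_e(\rho_ea_n)^\delta$, $\mu_{n2}=r_p^\alpha/(\rho_ea_n)$, $\varphi_n=\frac{M!}{(M-n)!\,(n-1)!}$. For an integer $K\ge1$ and $1\le k\le K$: $\phi_k=\cos\left(\frac{2k-1}{2K}\pi\right)$, $b_k=-\frac{\pi}{2K}\sqrt{1-\phi_k^2}\,(\phi_k+1)$, $c_k=1+\left[\frac{R_D}{2}(\phi_k+1)\right]^\alpha$; moreover $b_0=-\sum_{k=1}^Kb_k$ and $c_0=0$. Let $\tilde S_n^p=\{(q_0,\dots,q_K)\in\mathbb{Z}_{\ge0}^{K+1}:\sum_{i=0}^K q_i=n+p\}$, $\binom{n+p}{q_0,\dots,q_K}=\frac{(n+p)!}{q_0!\cdots q_K!}$, and $$f_{\gamma_{E_n}}(x)=\mu_{n1}e^{-\mu_{n1}\Gamma(\delta,\mu_{n2}x)/x^\delta}\left(\frac{\mu_{n2}^\delta e^{-\mu_{n2}x}}{x}+\frac{\delta\,\Gamma(\delta,\mu_{n2}x)}{x^{\delta+1}}\right),\qquad x>0,$$ $$F^{(K)}(x)=\varphi_n\sum_{p=0}^{M-n}\binom{M-n}{p}\frac{(-1)^p}{n+p}\sum_{\tilde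 S_n^p}\binom{n+p}{q_0,\dots,q_K}\left(\prod_{k=0}^Kb_k^{q_k}\right)e^{-\sum_{k=0}^Kq_kc_k\frac{x}{\rho_ba_n}},$$ $$P_n^{(K)}(R_n)=\varphi_n\sum_{p=0}^{M-n}\binom{M-n}{p}\frac{(-1)^p}{n+p}\sum_{\tilde S_n^p}\binom{n+p}{q_0,\dots,q_K}\left(\prod_{k=0}^Kb_k^{q_k}\right)\int_0^\infty\mu_{n1}\left(\frac{\mu_{n2}^\delta e^{-\mu_{n2}x}}{x}+\frac{\delta\,\Gamma(\delta,\mu_{n2}x)}{x^{\delta+1}}\right)e^{-\frac{\mu_{n1}\Gamma(\delta,\mu_{n2}x)}{x^\delta}-\sum_{k=0}^Kq_kc_k\frac{2^{R_n}(1+x)-1}{\rho_ba_n}}\,dx.$$ **Theorem 1.** The $n$-th user's secrecy outage probability is given by $P_n^{(K)}(R_n)$, up to a Gauss–Chebyshev quadrature error that vanishes as $K\to\infty$. Precisely: 1. $\gamma_{E_n}$ is almost surely finite and its law has density $f_{\gamma_{E_n}}$ on $(0,\infty)$. 2. $F^{(K)}(x)\to\Pr\{\gamma_{B_n}\le x\}$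 as $K\to\infty$, for every $x\ge0$. 3. $\mathrm{SOP}_n(R_n)=\int_0^\infty f_{\gamma_{E_n}}(x)\,\Pr\{\gamma_{B_n}\le2^{R_n}(1+x)-1\}\,dx$, the integral being absolutely convergent. 4. For every $K\ge1$ all the integrals in $P_n^{(K)}(R_n)$ converge absolutely, and $P_n^{(K)}(R_n)=\int_0^\infty f_{\gamma_{E_n}}(x)\,F^{(K)}\left(2^{R_n}(1+x)-1\right)dx$, also absolutely convergent. 5. $P_n^{(K)}(R_n)\to\mathrm{SOP}_n(R_n)$ as $K\to\infty$. -/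

import Mathlib

open MeasureTheory ProbabilityTheory

noncomputable section

namespace NOMA

/-- The plane; the base station sits at the origin. -/
abbrev Plane : Type := EuclideanSpace ℝ (Fin 2)

/-- The circularly symmetric complex Gaussian law `CN(0,1)`: independent real and imaginary
parts, each centred normal with variance `1/2`. -/
def stdComplexGaussian : Measure ℂ :=
  ((gaussianReal 0 (1 / 2)).prod (gaussianReal 0 (1 / 2))).map
    (fun p : ℝ × ℝ => (⟨p.1, p.2⟩ : ℂ))

/-- The number of points (counted with multiplicity) of the configuration `(X i ω)` in `B`. -/
def pointCount {Ω : Type*} (X : ℕ → Ω → Plane) (B : Set Plane) (ω : Ω) : ℕ∞ :=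
  Set.encard {i : ℕ | X i ω ∈ B}

/-- The random points `X 0, X 1, …` enumerate a homogeneous Poisson point process of
density `lam` on the plane: the number of points in a Borel set of finite area is Poisson with
mean `lam` times the area, and the numbers of points in disjoint Borel sets are independent.
(For `lam > 0` such a process almost surely has infinitely many points.) -/
structure IsHomogeneousPPP {Ω : Type*} [MeasurableSpace Ω] (X : ℕ → Ω → Plane) (lam : ℝ)
    (μ : Measure Ω) : Prop where
  measurable : ∀ i, Measurable (X i)
  count_law : ∀ B : Set Plane, MeasurableSet B → volume B ≠ ⊤ →
    HasLaw (pointCount X B)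
      ((poissonMeasure (lam * volume.real B).toNNReal).map (fun k : ℕ => (k : ℕ∞))) μ
  count_indep : ∀ (k : ℕ) (B : Fin k → Set Plane), (∀ j, MeasurableSet (B j)) →
    Pairwise (fun i j => Disjoint (B i) (B j)) →
    iIndepFun (fun j => pointCount X (B j)) μ

/-- The parameters of the network. -/
structure Params where
  /-- number of legitimate users -/
  M : ℕ
  /-- rank of the user under study when the channel gains are put in increasing order -/
  n : ℕ
  /-- power allocation coefficient of that user -/
  a : ℝ
  /-- transmit SNR at the legitimate users -/
  ρb : ℝ
  /-- transmit SNR at the eavesdroppers -/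
  ρe : ℝ
  /-- path-loss exponent -/
  α : ℝ
  /-- radius of the user disc -/
  RD : ℝ
  /-- radius of the eavesdropper-exclusion zone -/
  rp : ℝ
  /-- density of the eavesdroppers -/
  lam : ℝ
  one_le_n : 1 ≤ n
  n_le_M : n ≤ M
  a_pos : 0 < a
  ρb_pos : 0 < ρb
  ρe_pos : 0 < ρe
  α_pos : 0 < α
  RD_pos : 0 < RD
  rp_pos : 0 < rp
  lam_pos : 0 < lam

namespace Params

variable (P : Params)

/-! ### The random network -/

/-- `U i`, `H i` are the position and the small-scale fading coefficient of the `i`-th (unordered)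
legitimate user; `X j`, `G j` are those of the `j`-th eavesdropper. -/
structure IsNetwork {Ω : Type*} [MeasurableSpace Ω] (μ : Measure Ω)
    (U : Fin P.M → Ω → Plane) (H : Fin P.M → Ω → ℂ)
    (X : ℕ → Ω → Plane) (G : ℕ → Ω → ℂ) : Prop where
  measurable_U : ∀ i, Measurable (U i)
  measurable_H : ∀ i, Measurable (H i)
  measurable_G : ∀ j, Measurable (G j)
  /-- users are uniform in the disc -/
  law_U : ∀ i, pdf.IsUniform (U i) (Metric.closedBall 0 P.RD) μ volume
  /-- Rayleigh fading -/
  law_H : ∀ i, HasLaw (H i) stdComplexGaussian μ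
  law_G : ∀ j, HasLaw (G j) stdComplexGaussian μ
  /-- eavesdroppers form a homogeneous Poisson point process -/
  ppp : IsHomogeneousPPP X P.lam μ
  /-- all positions and fading coefficients are independent (the eavesdropper positions `X`
  count as one random object) -/
  indep_UH : ∀ i, IndepFun (U i) (H i) μ
  indep_users : iIndepFun (fun i ω => (U i ω, H i ω)) μ
  indep_G : iIndepFun G μ
  indep_XG : IndepFun (fun ω j => X j ω) (fun ω j => G j ω) μ
  indep_users_eves :
    IndepFun (fun ω i => (U i ω, H i ω)) (fun ω j => (X j ω, G j ω)) μ

/-- Unordered channel gain of a user with fading `h` at position `u`: fading power times the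
bounded path loss `1 / (1 + d ^ α)`. -/
def userGain (u : Plane) (h : ℂ) : ℝ := ‖h‖ ^ 2 / (1 + ‖u‖ ^ P.α)

/-- The `n`-th smallest of `M` real numbers. -/
def orderStat (v : Fin P.M → ℝ) : ℝ :=
  v (Tuple.sort v ⟨P.n - 1, by have := P.one_le_n; have := P.n_le_M; omega⟩)

/-- SNR of the `n`-th user after successful interference cancellation: `ρ_b a_n |h_n|²`. -/
def userSNR {Ω : Type*} (U : Fin P.M → Ω → Plane) (H : Fin P.M → Ω → ℂ) (ω : Ω) : ℝ :=
  P.ρb * P.a * P.orderStat (fun i => P.userGain (U i ω) (H i ω))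

/-- SNR of the most detrimental eavesdropper outside the exclusion zone, with path loss
`d ^ (-α)`. The supremum is taken in `[0, ∞]`. -/
def eveSNR {Ω : Type*} (X : ℕ → Ω → Plane) (G : ℕ → Ω → ℂ) (ω : Ω) : ENNReal :=
  ENNReal.ofReal (P.ρe * P.a) *
    ⨆ (j : ℕ) (_ : P.rp ≤ ‖X j ω‖), ENNReal.ofReal (‖G j ω‖ ^ 2 * (1 / ‖X j ω‖ ^ P.α))

end Params

/-- Secrecy rate `[log₂ (1 + b) - log₂ (1 + e)]⁺` for SNRs `b` (user) and `e` (eavesdropper). -/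
def secrecyRate (b : ℝ) (e : ENNReal) : ℝ :=
  if e = ⊤ then 0 else max (Real.logb 2 (1 + b) - Real.logb 2 (1 + e.toReal)) 0

namespace Params

variable (P : Params)

/-- Secrecy outage probability of the `n`-th user for the target secrecy rate `R`. -/
def sop {Ω : Type*} [MeasurableSpace Ω] (μ : Measure Ω)
    (U : Fin P.M → Ω → Plane) (H : Fin P.M → Ω → ℂ)
    (X : ℕ → Ω → Plane) (G : ℕ → Ω → ℂ) (R : ℝ) : ℝ :=
  μ.real {ω | secrecyRate (P.userSNR U H ω) (P.eveSNR X G ω) < R}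

end Params

/-! ### The quantities in the formula -/

/-- Upper incomplete Gamma function `Γ(s, x)`. -/
def upperGamma (s x : ℝ) : ℝ := ∫ t in Set.Ioi x, t ^ (s - 1) * Real.exp (-t)

/-- Gauss–Chebyshev node `φ_k = cos ((2k - 1) π / (2K))`. -/
def node (K k : ℕ) : ℝ := Real.cos ((2 * (k : ℝ) - 1) / (2 * (K : ℝ)) * Real.pi)

/-- `b_k` for `k ≥ 1`. -/
def weight (K k : ℕ) : ℝ :=
  -(Real.pi / (2 * (K : ℝ))) * Real.sqrt (1 - node K k ^ 2) * (node K k + 1)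

/-- `b_k` for `k ≥ 0`, with `b_0 = - ∑_{k = 1}^K b_k`. -/
def coeffB (K k : ℕ) : ℝ :=
  if k = 0 then -∑ j ∈ Finset.Icc 1 K, weight K j else weight K k

namespace Params

variable (P : Params)

/-- `c_0 = 0` and `c_k = 1 + (R_D / 2 * (φ_k + 1)) ^ α` for `k ≥ 1`. -/
def coeffC (K k : ℕ) : ℝ :=
  if k = 0 then 0 else 1 + (P.RD / 2 * (node K k + 1)) ^ P.α

/-- `φ_n = M! / ((M - n)! (n - 1)!)`. -/
def phi : ℝ := (P.M.factorial : ℝ) / ((P.M - P.n).factorial * (P.n - 1).factorial)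

def δ : ℝ := 2 / P.α

def μ₁ : ℝ := P.δ * Real.pi * P.lam * (P.ρe * P.a) ^ P.δ

def μ₂ : ℝ := P.rp ^ P.α / (P.ρe * P.a)

/-- Probability density of the SNR of the most detrimental eavesdropper (for `x > 0`). -/
def evePDF (x : ℝ) : ℝ :=
  P.μ₁ * Real.exp (-(P.μ₁ * upperGamma P.δ (P.μ₂ * x) / x ^ P.δ)) *
    (P.μ₂ ^ P.δ * Real.exp (-(P.μ₂ * x)) / x
      + P.δ * upperGamma P.δ (P.μ₂ * x) / x ^ (P.δ + 1))

/-- The index set `{(q_0, …, q_K) | ∑ q_i = n + p}`. -/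
def indexSet (K p : ℕ) : Finset (Fin (K + 1) → ℕ) :=
  Finset.piAntidiag Finset.univ (P.n + p)

/-- The `K`-node Gauss–Chebyshev approximation of the distribution function of the SNR of the
`n`-th user. -/
def approxCDF (K : ℕ) (x : ℝ) : ℝ :=
  P.phi * ∑ p ∈ Finset.range (P.M - P.n + 1),
    ((P.M - P.n).choose p : ℝ) * ((-1) ^ p / ((P.n : ℝ) + p)) *
      ∑ q ∈ P.indexSet K p,
        (Nat.multinomial Finset.univ q : ℝ) * (∏ k : Fin (K + 1), coeffB K k ^ q k) *
          Real.exp (-∑ k : Fin (K + 1), (q k : ℝ) * P.coeffC K k * (x / (P.ρb * P.a)))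

/-- The integrand of the single integral attached to the multi-index `q`. -/
def sopIntegrand (K : ℕ) (q : Fin (K + 1) → ℕ) (R x : ℝ) : ℝ :=
  P.μ₁ * (P.μ₂ ^ P.δ * Real.exp (-(P.μ₂ * x)) / x
      + P.δ * upperGamma P.δ (P.μ₂ * x) / x ^ (P.δ + 1)) *
    Real.exp (-(P.μ₁ * upperGamma P.δ (P.μ₂ * x) / x ^ P.δ)
      - ∑ k : Fin (K + 1), (q k : ℝ) * P.coeffC K k * (((2 : ℝ) ^ R * (1 + x) - 1) / (P.ρb * P.a)))

/-- The closed-form `K`-node expression for the secrecy outage probability. -/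
def sopFormula (K : ℕ) (R : ℝ) : ℝ :=
  P.phi * ∑ p ∈ Finset.range (P.M - P.n + 1),
    ((P.M - P.n).choose p : ℝ) * ((-1) ^ p / ((P.n : ℝ) + p)) *
      ∑ q ∈ P.indexSet K p,
        (Nat.multinomial Finset.univ q : ℝ) * (∏ k : Fin (K + 1), coeffB K k ^ q k) *
          ∫ x in Set.Ioi (0 : ℝ), P.sopIntegrand K q R x

end Params

end NOMA

end

/-! The user side and the eavesdropper side are independent. Given γ_E = x, outage means γ_B < 2^R
(1 + x) - 1. Since γ_B has no atoms, the inequality may be weakened, and the outage probability is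
the integral of the density of γ_E against the distribution function of γ_B (`IsNetwork.sop_eq`).

Eavesdroppers: γ_E ≤ x says that no pair (position, fading) lies in the set where |u| ≥ r_p and |z|²
> x |u|^α / (ρ_e a). Given the positions, this has probability ∏ (1 - g(X_j)), where g(u) = exp(-x
|u|^α / (ρ_e a)) for |u| ≥ r_p and g(u) = 0 otherwise. The generating functional E ∏ (1 - g(X_j)) =
exp(-λ ∫ g) (`IsHomogeneousPPP.lintegral_iInf_prod`) yields the distribution function, and polar
coordinates turn ∫ g into an incomplete Gamma function. The derivative is `evePDF`; the limits 0 at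
0+ and 1 at ∞ show that the density carries the whole mass, so that γ_E is almost surely finite and
positive.

Users: the distribution function of one gain averages 1 - exp(-(1 + r^α) t) over the disc. For the
n-th order statistic, independence gives a binomial tail, which is the polynomial `orderPoly` in
that function (`sum_bernsteinPolynomial_tail`). Under r = R_D / 2 (cos θ + 1) the Gauss–Chebyshev
sum becomes a midpoint Riemann sum in θ, so it converges (`approxGainCDF_eq`,
`tendsto_midpoint_sum`), and the multinomial theorem expands `orderPoly` of this sum into
`approxCDF`. A bound uniform in K allows dominated convergence in the last integral. -/

noncomputable section

namespace NOMA

section GeneratingFunctional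

/-! ### The generating functional of a homogeneous Poisson process -/

lemma lintegral_pow_poissonMeasure (r : NNReal) {t : ℝ} (ht : 0 ≤ t) :
    ∫⁻ k : ℕ, ENNReal.ofReal t ^ k ∂poissonMeasure r
      = ENNReal.ofReal (Real.exp (-(r * (1 - t)))) := by
  rw [lintegral_countable']
  have hs : HasSum (fun k : ℕ => Real.exp (-r) * ((r * t) ^ k / k.factorial))
      (Real.exp (-r) * Real.exp (r * t)) := by
    have := NormedSpace.expSeries_div_hasSum_exp (𝔸 := ℝ) ((r : ℝ) * t)
    rw [← Real.exp_eq_exp_ℝ] at this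
    exact this.mul_left _
  have : ∀ k : ℕ, ENNReal.ofReal t ^ k * poissonMeasure r {k}
      = ENNReal.ofReal (Real.exp (-r) * ((r * t) ^ k / k.factorial)) := by
    intro k
    rw [poissonMeasure_singleton, ← ENNReal.ofReal_pow ht, ← ENNReal.ofReal_mul (by positivity)]
    congr 1
    rw [mul_pow]; ring
  simp_rw [this]
  rw [← ENNReal.ofReal_tsum_of_nonneg (fun k => by positivity) hs.summable, hs.tsum_eq,
    ← Real.exp_add]
  congr 2; ring

lemma antitone_prod_range {f : ℕ → ENNReal} (hf : ∀ j, f j ≤ 1) :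
    Antitone (fun N => ∏ j ∈ Finset.range N, f j) := by
  refine antitone_nat_of_succ_le fun N => ?_
  rw [Finset.prod_range_succ]
  exact mul_le_of_le_one_right' (hf N)

/-- The infinite product of the values of `1 - s`, for a simple `s`, in terms of the numbers of
points in the level sets of `s`. -/
lemma iInf_prod_one_sub_simpleFunc (s : SimpleFunc Plane ENNReal) (x : ℕ → Plane)
    (hfin : ∀ v ∈ s.range.filter (· ≠ 0), Set.encard {j | x j ∈ s ⁻¹' {v}} ≠ ⊤) :
    ⨅ N, ∏ j ∈ Finset.range N, (1 - s (x j))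
      = ∏ v ∈ s.range.filter (· ≠ 0), (1 - v) ^ (Set.encard {j | x j ∈ s ⁻¹' {v}}).toNat := by
  classical
  have hT : {j | s (x j) ≠ 0}.Finite := by
    have : {j | s (x j) ≠ 0} ⊆ ⋃ v ∈ s.range.filter (· ≠ 0), {j | x j ∈ s ⁻¹' {v}} := by
      intro j hj
      simp only [Set.mem_iUnion]
      exact ⟨s (x j), by simpa using hj, rfl⟩
    refine Set.Finite.subset (Set.Finite.biUnion (Finset.finite_toSet _) fun v hv => ?_) this
    exact Set.encard_ne_top_iff.1 (hfin v hv)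
  have hprod : ∏ j ∈ hT.toFinset, (1 - s (x j))
      = ∏ v ∈ s.range.filter (· ≠ 0),
          (1 - v) ^ (Set.encard {j | x j ∈ s ⁻¹' {v}}).toNat := by
    rw [← Finset.prod_fiberwise_of_maps_to (t := s.range.filter (· ≠ 0))
      (g := fun j => s (x j)) (by intro j hj; simpa using hj)]
    refine Finset.prod_congr rfl fun v hv => ?_
    have h1 : ∀ j ∈ hT.toFinset.filter (fun j => s (x j) = v), 1 - s (x j) = 1 - v := by
      intro j hj
      rw [(Finset.mem_filter.1 hj).2]
    rw [Finset.prod_congr rfl h1, Finset.prod_const]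
    congr 1
    have h2 : {j | x j ∈ s ⁻¹' {v}} = (hT.toFinset.filter (fun j => s (x j) = v) : Set ℕ) := by
      ext j
      have := (Finset.mem_filter.1 hv).2
      simp only [Set.mem_preimage, Set.mem_singleton_iff, Set.mem_ofPred_eq, Finset.coe_filter,
        Set.Finite.mem_toFinset]
      constructor
      · intro h; exact ⟨h ▸ this, h⟩
      · exact fun h => h.2
    rw [h2, Set.encard_coe_eq_coe_finsetCard]
    rfl
  -- Only finitely many factors differ from 1, so the partial products are constant beyond the last
  -- such index; being antitone, they attain their infimum there.
  obtain ⟨N₀, hN₀⟩ := hT.bddAbove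
  have hev : ∀ N, N₀ + 1 ≤ N →
      ∏ j ∈ Finset.range N, (1 - s (x j)) = ∏ j ∈ hT.toFinset, (1 - s (x j)) := by
    intro N hN
    symm
    refine Finset.prod_subset ?_ ?_
    · intro j hj
      have := hN₀ (hT.mem_toFinset.1 hj)
      exact Finset.mem_range.2 (by omega)
    · intro j _ hj
      have : s (x j) = 0 := by simpa using hj
      simp [this]
  rw [← hprod]
  refine le_antisymm ?_ (le_iInf fun N => ?_)
  · rw [← hev _ le_rfl]; exact iInf_le _ _
  · rw [← hev (max N (N₀ + 1)) (le_max_right _ _)]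
    exact antitone_prod_range (fun j => tsub_le_self) (le_max_left N (N₀ + 1))

variable {Ω : Type*} [MeasurableSpace Ω] {μ : Measure Ω}
  {X : ℕ → Ω → Plane} {lam : ℝ}

lemma IsHomogeneousPPP.ae_pointCount_ne_top (hX : IsHomogeneousPPP X lam μ) {B : Set Plane}
    (hB : MeasurableSet B) (hvol : volume B ≠ ⊤) : ∀ᵐ ω ∂μ, pointCount X B ω ≠ ⊤ := by
  have h := hX.count_law B hB hvol
  have h2 : ∀ᵐ k ∂(μ.map (pointCount X B)), k ≠ ⊤ := by
    rw [h.map_eq, ae_map_iff (by fun_prop) (MeasurableSet.of_discrete)]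
    simp
  exact ae_of_ae_map h.aemeasurable h2

lemma IsHomogeneousPPP.lintegral_pow_pointCount (hX : IsHomogeneousPPP X lam μ) (hlam : 0 ≤ lam)
    {B : Set Plane} (hB : MeasurableSet B) (hvol : volume B ≠ ⊤) {v : ENNReal} (hv : v ≤ 1) :
    ∫⁻ ω, (1 - v) ^ (pointCount X B ω).toNat ∂μ
      = ENNReal.ofReal (Real.exp (-(lam * (v * volume B).toReal))) := by
  have h := hX.count_law B hB hvol
  rw [← lintegral_map' (f := fun k : ℕ∞ => (1 - v) ^ k.toNat)
    (Measurable.of_discrete).aemeasurable h.aemeasurable, h.map_eq,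
    lintegral_map (Measurable.of_discrete) (by fun_prop)]
  have hv' : v ≠ ⊤ := ne_top_of_le_ne_top ENNReal.one_ne_top hv
  have hvr : v.toReal ≤ 1 := by
    rw [← ENNReal.toReal_one]; exact ENNReal.toReal_mono ENNReal.one_ne_top hv
  have h1 : 1 - v = ENNReal.ofReal (1 - v.toReal) := by
    rw [ENNReal.ofReal_sub _ ENNReal.toReal_nonneg, ENNReal.ofReal_toReal hv',
      ENNReal.ofReal_one]
  simp only [ENat.toNat_natCast, h1]
  rw [lintegral_pow_poissonMeasure _ (by linarith), ENNReal.toReal_mul,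
    Real.coe_toNNReal _ (by positivity), Measure.real]
  congr 2; ring

/-- The level sets of the nonzero values are disjoint, so their counts are independent and the
expectation factors into Poisson generating functions, whose exponents add up to the integral of
`s`. The value 0 is left out: it contributes factors 1, and its level set may have infinite area. -/
lemma IsHomogeneousPPP.lintegral_iInf_prod_simpleFunc [IsProbabilityMeasure μ]
    (hX : IsHomogeneousPPP X lam μ)
    (hlam : 0 ≤ lam) (s : SimpleFunc Plane ENNReal) (hs : ∀ u, s u ≤ 1)
    (hfin : ∫⁻ u, s u ≠ ⊤) :
    ∫⁻ ω, ⨅ N, ∏ j ∈ Finset.range N, (1 - s (X j ω)) ∂μ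
      = ENNReal.ofReal (Real.exp (-(lam * (∫⁻ u, s u).toReal))) := by
  classical
  set S := s.range.filter (· ≠ 0) with hS
  have hterm : ∀ v ∈ s.range, v * volume (s ⁻¹' {v}) ≠ ⊤ := by
    intro v hv
    rw [SimpleFunc.lintegral_eq_lintegral, SimpleFunc.lintegral] at hfin
    exact (ENNReal.sum_ne_top.1 hfin) v hv
  have hvol : ∀ v ∈ S, volume (s ⁻¹' {v}) ≠ ⊤ := by
    intro v hv htop
    have := hterm v (Finset.mem_filter.1 hv).1
    rw [htop, ENNReal.mul_top (Finset.mem_filter.1 hv).2] at this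
    exact this rfl
  have hv1 : ∀ v ∈ S, v ≤ 1 := by
    intro v hv
    obtain ⟨u, rfl⟩ := SimpleFunc.mem_range.1 (Finset.mem_filter.1 hv).1
    exact hs u
  have hae : ∀ᵐ ω ∂μ, ⨅ N, ∏ j ∈ Finset.range N, (1 - s (X j ω))
      = ∏ v ∈ S, (1 - v) ^ (pointCount X (s ⁻¹' {v}) ω).toNat := by
    have : ∀ᵐ ω ∂μ, ∀ v ∈ S, pointCount X (s ⁻¹' {v}) ω ≠ ⊤ := by
      rw [Finset.eventually_all]
      exact fun v hv => hX.ae_pointCount_ne_top (s.measurableSet_fiber v) (hvol v hv)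
    filter_upwards [this] with ω hω
    exact iInf_prod_one_sub_simpleFunc s (fun j => X j ω) hω
  rw [lintegral_congr_ae hae]
  let e := S.equivFin
  let B : Fin S.card → Set Plane := fun i => s ⁻¹' {(e.symm i : ENNReal)}
  have hB : ∀ i, MeasurableSet (B i) := fun i => s.measurableSet_fiber _
  have hdisj : Pairwise (fun i j => Disjoint (B i) (B j)) := by
    intro i j hij
    refine Disjoint.preimage _ (Set.disjoint_singleton.2 fun h => hij ?_)
    exact e.symm.injective (Subtype.ext h)
  have hind := hX.count_indep _ B hB hdisj
  have hreindex : ∀ F : ENNReal → ENNReal,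
      ∏ v ∈ S, F v = ∏ i : Fin S.card, F (e.symm i) := by
    intro F
    rw [← Finset.prod_coe_sort]
    exact (Equiv.prod_comp e.symm (fun v : S => F v)).symm
  -- `HasLaw` provides only a.e. measurability, whereas the product formula below asks for
  -- measurable factors; the counts are therefore replaced by measurable versions.
  have hmeas : ∀ i, AEMeasurable (pointCount X (B i)) μ := fun i =>
    (hX.count_law (B i) (hB i) (hvol _ (e.symm i).2)).aemeasurable
  have hae2 : ∀ i, pointCount X (B i) =ᵐ[μ] (hmeas i).mk _ := fun i => (hmeas i).ae_eq_mk
  have hind2 : iIndepFun (fun i ω => (1 - (e.symm i : ENNReal)) ^ ((hmeas i).mk _ ω).toNat) μ :=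
    (hind.congr hae2).comp (fun i (k : ℕ∞) => (1 - (e.symm i : ENNReal)) ^ k.toNat)
      (fun i => Measurable.of_discrete)
  have hint := lintegral_prod_eq_prod_lintegral_of_indepFun Finset.univ _ hind2
    (fun i => (Measurable.of_discrete
      (f := fun k : ℕ∞ => (1 - (e.symm i : ENNReal)) ^ k.toNat)).comp (hmeas i).measurable_mk)
  calc ∫⁻ ω, ∏ v ∈ S, (1 - v) ^ (pointCount X (s ⁻¹' {v}) ω).toNat ∂μ
      = ∫⁻ ω, ∏ i, (1 - (e.symm i : ENNReal)) ^ ((hmeas i).mk _ ω).toNat ∂μ := by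
        refine lintegral_congr_ae ?_
        filter_upwards [ae_all_iff.2 hae2] with ω hω
        rw [hreindex (fun v => (1 - v) ^ (pointCount X (s ⁻¹' {v}) ω).toNat)]
        exact Finset.prod_congr rfl fun i _ => by rw [← hω i]
    _ = ∏ i, ∫⁻ ω, (1 - (e.symm i : ENNReal)) ^ ((hmeas i).mk _ ω).toNat ∂μ := hint
    _ = ∏ i, ENNReal.ofReal (Real.exp (-(lam * ((e.symm i : ENNReal) *
          volume (s ⁻¹' {(e.symm i : ENNReal)})).toReal))) := by
        refine Finset.prod_congr rfl fun i _ => ?_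
        rw [← hX.lintegral_pow_pointCount hlam (hB i) (hvol _ (e.symm i).2) (hv1 _ (e.symm i).2)]
        refine lintegral_congr_ae ?_
        filter_upwards [hae2 i] with ω hω
        rw [hω]
    _ = ∏ v ∈ S, ENNReal.ofReal (Real.exp (-(lam * (v * volume (s ⁻¹' {v})).toReal))) :=
        (hreindex (fun v =>
          ENNReal.ofReal (Real.exp (-(lam * (v * volume (s ⁻¹' {v})).toReal))))).symm
    _ = ENNReal.ofReal (Real.exp (-(lam * (∫⁻ u, s u).toReal))) := by
        rw [← ENNReal.ofReal_prod_of_nonneg (fun _ _ => (Real.exp_pos _).le), ← Real.exp_sum,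
          Finset.sum_neg_distrib, ← Finset.mul_sum, SimpleFunc.lintegral_eq_lintegral,
          SimpleFunc.lintegral, ENNReal.toReal_sum hterm, hS, Finset.sum_filter]
        congr 4
        refine Finset.sum_congr rfl fun v _ => ?_
        by_cases hv : v = 0 <;> simp [hv]

/-- The generating functional of a homogeneous Poisson process. -/
lemma IsHomogeneousPPP.lintegral_iInf_prod [IsProbabilityMeasure μ] (hX : IsHomogeneousPPP X lam μ)
    (hlam : 0 ≤ lam) {g : Plane → ENNReal} (hg : Measurable g) (hg1 : ∀ u, g u ≤ 1)
    (hfin : ∫⁻ u, g u ≠ ⊤) :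
    ∫⁻ ω, ⨅ N, ∏ j ∈ Finset.range N, (1 - g (X j ω)) ∂μ
      = ENNReal.ofReal (Real.exp (-(lam * (∫⁻ u, g u).toReal))) := by
  let s : ℕ → SimpleFunc Plane ENNReal := SimpleFunc.eapprox g
  have hmono : ∀ u, Monotone fun m => s m u := fun u m n hmn => SimpleFunc.monotone_eapprox g hmn u
  have hsup : ∀ u, ⨆ m, s m u = g u := SimpleFunc.iSup_eapprox_apply hg
  have hle : ∀ m u, s m u ≤ g u := fun m u => (hsup u) ▸ le_iSup (fun m => s m u) m
  have hint : ∀ m, ∫⁻ u, s m u ≠ ⊤ := fun m =>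
    ne_top_of_le_ne_top hfin (lintegral_mono (hle m))
  have hpt : ∀ ω, ⨅ N, ∏ j ∈ Finset.range N, (1 - g (X j ω))
      = ⨅ m, ⨅ N, ∏ j ∈ Finset.range N, (1 - s m (X j ω)) := by
    intro ω
    -- With the infima exchanged, N is fixed, and only continuity of a finite product along the
    -- increasing simple approximations is needed.
    rw [iInf_comm]
    refine iInf_congr fun N => ?_
    have hlim : Filter.Tendsto (fun m => ∏ j ∈ Finset.range N, (1 - s m (X j ω))) Filter.atTop
        (nhds (∏ j ∈ Finset.range N, (1 - g (X j ω)))) := by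
      refine ENNReal.tendsto_finsetProd_of_ne_top _ (fun j _ => ?_)
        (fun j _ => ne_top_of_le_ne_top ENNReal.one_ne_top tsub_le_self)
      refine ENNReal.Tendsto.sub tendsto_const_nhds ?_ (Or.inl ENNReal.one_ne_top)
      rw [← hsup (X j ω)]
      exact tendsto_atTop_iSup (hmono _)
    refine tendsto_nhds_unique hlim (tendsto_atTop_iInf fun m n hmn => ?_)
    exact Finset.prod_le_prod' fun j _ => tsub_le_tsub_left (hmono _ hmn) _
  have hmeasX := hX.measurable
  have hmeas : ∀ m, Measurable fun ω => ⨅ N, ∏ j ∈ Finset.range N, (1 - s m (X j ω)) := by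
    intro m
    refine Measurable.iInf fun N => Finset.measurable_prod _ fun j _ => ?_
    exact measurable_const.sub ((s m).measurable.comp (hmeasX j))
  simp_rw [hpt]
  have hanti : Antitone fun (m : ℕ) ω => ⨅ N, ∏ j ∈ Finset.range N, (1 - s m (X j ω)) := by
    intro m n hmn ω
    exact iInf_mono fun N => Finset.prod_le_prod' fun j _ => tsub_le_tsub_left (hmono _ hmn) _
  have hval : ∀ m, ∫⁻ ω, ⨅ N, ∏ j ∈ Finset.range N, (1 - s m (X j ω)) ∂μ
      = ENNReal.ofReal (Real.exp (-(lam * (∫⁻ u, s m u).toReal))) := fun m =>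
    hX.lintegral_iInf_prod_simpleFunc hlam (s m) (fun u => (hle m u).trans (hg1 u)) (hint m)
  rw [lintegral_iInf hmeas hanti (by rw [hval]; exact ENNReal.ofReal_ne_top)]
  simp_rw [hval]
  have hlimint : Filter.Tendsto (fun m => ∫⁻ u, s m u) Filter.atTop (nhds (∫⁻ u, g u)) := by
    have : ∫⁻ u, g u = ⨆ m, ∫⁻ u, s m u := by
      rw [← lintegral_iSup (fun m => (s m).measurable) (fun m n hmn u => hmono u hmn)]
      exact lintegral_congr fun u => (hsup u).symm
    rw [this]
    exact tendsto_atTop_iSup fun m n hmn => lintegral_mono fun u => hmono u hmn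
  refine tendsto_nhds_unique (tendsto_atTop_iInf fun m n hmn => ?_) (b := ENNReal.ofReal
    (Real.exp (-(lam * (∫⁻ u, g u).toReal)))) ?_
  · refine ENNReal.ofReal_le_ofReal (Real.exp_le_exp.2 (neg_le_neg ?_))
    exact mul_le_mul_of_nonneg_left
      (ENNReal.toReal_mono (hint n) (lintegral_mono fun u => hmono u hmn)) hlam
  · refine (ENNReal.continuous_ofReal.comp Real.continuous_exp).continuousAt.tendsto.comp ?_
    exact (((ENNReal.tendsto_toReal hfin).comp hlimint).const_mul lam).neg

end GeneratingFunctional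

section Integrals

/-! ### Fading powers and radial integrals -/

/-- The product of two N(0, 1/2) densities is the radial function π⁻¹ exp(-|z|²), which makes polar
integration available. -/
lemma stdComplexGaussian_eq_withDensity :
    stdComplexGaussian
      = volume.withDensity (fun z : ℂ => ENNReal.ofReal (Real.pi⁻¹ * Real.exp (-‖z‖ ^ 2))) := by
  have hpdf : ∀ x y : ℝ, gaussianPDF 0 (1 / 2) x * gaussianPDF 0 (1 / 2) y
      = ENNReal.ofReal (Real.pi⁻¹ * Real.exp (-‖(⟨x, y⟩ : ℂ)‖ ^ 2)) := by
    intro x y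
    rw [gaussianPDF, gaussianPDF, ← ENNReal.ofReal_mul (gaussianPDFReal_nonneg _ _ _)]
    congr 1
    simp only [gaussianPDFReal, Complex.sq_norm, Complex.normSq_mk]
    have h2 : (2 : ℝ) * Real.pi * ((1 / 2 : NNReal) : ℝ) = Real.pi := by push_cast; ring
    rw [h2]
    have h3 : ∀ u : ℝ, -(u - 0) ^ 2 / (2 * ((1 / 2 : NNReal) : ℝ)) = -(u * u) := by
      intro u; push_cast; ring
    rw [h3, h3, mul_mul_mul_comm, ← mul_inv, Real.mul_self_sqrt Real.pi_pos.le, ← Real.exp_add]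
    congr 2; ring
  have hmp := Complex.volume_preserving_equiv_real_prod.symm
  have hfun : (fun p : ℝ × ℝ => (⟨p.1, p.2⟩ : ℂ)) = Complex.measurableEquivRealProd.symm := rfl
  have hv : (1 / 2 : NNReal) ≠ 0 := by norm_num
  rw [stdComplexGaussian, gaussianReal_of_var_ne_zero 0 hv,
    prod_withDensity (measurable_gaussianPDF _ _) (measurable_gaussianPDF _ _), hfun,
    ← Measure.volume_eq_prod]
  ext s hs
  rw [Measure.map_apply (MeasurableEquiv.measurable _) hs, withDensity_apply _
    ((MeasurableEquiv.measurable _) hs), withDensity_apply _ hs,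
    ← hmp.setLIntegral_comp_preimage hs (by fun_prop)]
  exact lintegral_congr fun p => hpdf p.1 p.2

instance : IsProbabilityMeasure stdComplexGaussian :=
  Measure.isProbabilityMeasure_map
    (Complex.measurableEquivRealProd.symm.measurable.aemeasurable)

/-- Polar integration of a radial function on the plane. -/
lemma integral_plane_norm (f : ℝ → ℝ) :
    ∫ u : Plane, f ‖u‖ = 2 * Real.pi * ∫ y in Set.Ioi (0 : ℝ), y * f y := by
  have := integral_fun_norm_addHaar (volume : Measure Plane) f
  rw [this]
  simp [Measure.real, EuclideanSpace.volume_ball_fin_two, Real.pi_pos.le, mul_assoc]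

lemma integral_complex_norm (f : ℝ → ℝ) :
    ∫ z : ℂ, f ‖z‖ = 2 * Real.pi * ∫ y in Set.Ioi (0 : ℝ), y * f y := by
  have := integral_fun_norm_addHaar (volume : Measure ℂ) f
  rw [this]
  simp [Measure.real, Complex.volume_ball, mul_assoc]

lemma integral_Ioi_two_mul_exp_neg_sq {t : ℝ} (ht : 0 ≤ t) :
    ∫ y in Set.Ioi t, 2 * y * Real.exp (-y ^ 2) = Real.exp (-t ^ 2) := by
  have hd : ∀ y : ℝ, HasDerivAt (fun y : ℝ => -Real.exp (-y ^ 2)) (2 * y * Real.exp (-y ^ 2)) y := by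
    intro y
    refine ((hasDerivAt_pow 2 y).neg.exp).neg.congr_deriv ?_
    simp; ring
  have hlim : Filter.Tendsto (fun y : ℝ => -Real.exp (-y ^ 2)) Filter.atTop (nhds 0) := by
    rw [← neg_zero]
    refine (Real.tendsto_exp_atBot.comp ?_).neg
    exact Filter.tendsto_neg_atTop_atBot.comp (Filter.tendsto_pow_atTop two_ne_zero)
  rw [integral_Ioi_of_hasDerivAt_of_nonneg (hd t).continuousAt.continuousWithinAt
    (fun y _ => hd y) (fun y hy => ?_) hlim]
  · simp
  · have : 0 ≤ y := ht.trans (le_of_lt hy)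
    positivity

/-- The density is radial, so polar coordinates leave the integral of 2y exp(-y²) over y > √t. The
fading power is thus exponential with mean 1. -/
lemma stdComplexGaussian_tail {t : ℝ} (ht : 0 ≤ t) :
    stdComplexGaussian {z | t < ‖z‖ ^ 2} = ENNReal.ofReal (Real.exp (-t)) := by
  have hs : MeasurableSet {z : ℂ | t < ‖z‖ ^ 2} := measurableSet_lt (by fun_prop) (by fun_prop)
  have key : stdComplexGaussian.real {z | t < ‖z‖ ^ 2} = Real.exp (-t) := by
    have h1 : stdComplexGaussian.real {z | t < ‖z‖ ^ 2}
        = ∫ z : ℂ, (fun y : ℝ => if t < y ^ 2 then Real.pi⁻¹ * Real.exp (-y ^ 2) else 0) ‖z‖ := by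
      rw [Measure.real, stdComplexGaussian_eq_withDensity, withDensity_apply _ hs,
        ← integral_eq_lintegral_of_nonneg_ae, ← integral_indicator hs]
      · refine integral_congr_ae (ae_of_all _ fun z => ?_)
        simp [Set.indicator_apply]
      · exact ae_of_all _ fun z => by positivity
      · exact Measurable.aestronglyMeasurable (by fun_prop)
    rw [h1, integral_complex_norm (fun y : ℝ =>
      if t < y ^ 2 then Real.pi⁻¹ * Real.exp (-y ^ 2) else 0)]
    have h2 : ∫ y in Set.Ioi (0 : ℝ), y * (if t < y ^ 2 then Real.pi⁻¹ * Real.exp (-y ^ 2) else 0)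
        = ∫ y in Set.Ioi (Real.sqrt t), (2 * Real.pi)⁻¹ * (2 * y * Real.exp (-y ^ 2)) := by
      rw [← integral_indicator measurableSet_Ioi, ← integral_indicator measurableSet_Ioi]
      congr 1
      ext y
      simp only [Set.indicator_apply, Set.mem_Ioi]
      by_cases hy : 0 < y
      · have hiff : t < y ^ 2 ↔ Real.sqrt t < y := (Real.sqrt_lt' hy).symm
        simp only [hy, hiff, if_true]
        split_ifs
        · field_simp
        · simp
      · have : ¬ Real.sqrt t < y := fun h => hy ((Real.sqrt_nonneg t).trans_lt h)
        simp [hy, this]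
    rw [h2, integral_const_mul]
    rw [integral_Ioi_two_mul_exp_neg_sq (Real.sqrt_nonneg t), Real.sq_sqrt ht]
    have := Real.pi_pos.ne'
    field_simp
  rw [← key, ofReal_measureReal]

/-- Circles are Lebesgue-null. This is the source of the absence of atoms in the law of the user's
SNR. -/
lemma stdComplexGaussian_sphere (t : ℝ) : stdComplexGaussian {z | ‖z‖ ^ 2 = t} = 0 := by
  rw [stdComplexGaussian_eq_withDensity]
  refine (withDensity_absolutelyContinuous _ _) ?_
  refine measure_mono_null (t := Metric.sphere 0 (Real.sqrt t)) ?_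
    (Measure.addHaar_sphere _ _ _)
  intro z hz
  have : ‖z‖ ^ 2 = t := hz
  simp [← this]

/-! ### The upper incomplete Gamma function -/

lemma integrableOn_gamma {s x : ℝ} (hs : 0 < s) (hx : 0 ≤ x) :
    IntegrableOn (fun t => t ^ (s - 1) * Real.exp (-t)) (Set.Ioi x) := by
  have := Real.GammaIntegral_convergent hs
  refine (this.mono_set (Set.Ioi_subset_Ioi hx)).congr_fun (fun t _ => mul_comm _ _)
    measurableSet_Ioi

lemma upperGamma_pos {s x : ℝ} (hs : 0 < s) (hx : 0 ≤ x) : 0 < upperGamma s x := by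
  rw [upperGamma, setIntegral_pos_iff_support_of_nonneg_ae _ (integrableOn_gamma hs hx)]
  · have : Set.Ioi x ⊆ Function.support (fun t => t ^ (s - 1) * Real.exp (-t)) := by
      intro t ht
      have : 0 < t := hx.trans_lt ht
      exact (by positivity : 0 < t ^ (s - 1) * Real.exp (-t)).ne'
    rw [Set.inter_eq_right.2 this]
    simp
  · filter_upwards [ae_restrict_mem measurableSet_Ioi] with t ht
    have : 0 < t := hx.trans_lt ht
    simp only [Pi.zero_apply]
    positivity

lemma upperGamma_antitone {s x y : ℝ} (hs : 0 < s) (hx : 0 ≤ x) (hxy : x ≤ y) :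
    upperGamma s y ≤ upperGamma s x := by
  refine setIntegral_mono_set (integrableOn_gamma hs hx) ?_
    (Set.Ioi_subset_Ioi hxy).eventuallyLE
  filter_upwards [ae_restrict_mem measurableSet_Ioi] with t ht
  have : 0 < t := hx.trans_lt ht
  simp only [Pi.zero_apply]
  positivity

/-- Near x > 0 the function is Γ(s, 0) minus the integral over [0, y], so the fundamental theorem of
calculus applies. -/
lemma hasDerivAt_upperGamma {s x : ℝ} (hs : 0 < s) (hx : 0 < x) :
    HasDerivAt (upperGamma s) (-(x ^ (s - 1) * Real.exp (-x))) x := by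
  set f : ℝ → ℝ := fun t => t ^ (s - 1) * Real.exp (-t) with hf
  have hcont : ContinuousAt f x :=
    (Real.continuousAt_rpow_const _ _ (Or.inl hx.ne')).mul (by fun_prop)
  have hint : ∀ y : ℝ, 0 ≤ y → IntervalIntegrable f volume 0 y := by
    intro y hy
    rw [intervalIntegrable_iff_integrableOn_Ioc_of_le hy]
    exact (integrableOn_gamma hs le_rfl).mono_set Set.Ioc_subset_Ioi_self
  have hmeas : StronglyMeasurableAtFilter f (nhds x) volume := by
    refine (Measurable.aestronglyMeasurable (by fun_prop)).stronglyMeasurableAtFilter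
  have hF := intervalIntegral.integral_hasDerivAt_right (hint x hx.le) hmeas hcont
  have heq : upperGamma s =ᶠ[nhds x] fun y => upperGamma s 0 - ∫ t in (0 : ℝ)..y, f t := by
    filter_upwards [lt_mem_nhds hx] with y hy
    rw [intervalIntegral.integral_of_le hy.le, upperGamma, upperGamma, eq_sub_iff_add_eq,
      add_comm, ← setIntegral_union (Set.Ioc_disjoint_Ioi le_rfl) measurableSet_Ioi
      ((integrableOn_gamma hs le_rfl).mono_set Set.Ioc_subset_Ioi_self)
      (integrableOn_gamma hs hy.le), Set.Ioc_union_Ioi_eq_Ioi hy.le]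
  exact (hF.const_sub (upperGamma s 0)).congr_of_eventuallyEq heq

/-- A radial integral evaluated by the upper incomplete Gamma function. -/
lemma integral_Ioi_exp_neg_rpow {α k r : ℝ} (hα : 0 < α) (hk : 0 < k) (hr : 0 < r) :
    ∫ y in Set.Ioi (0 : ℝ), y * (if r ≤ y then Real.exp (-(k * y ^ α)) else 0)
      = α⁻¹ * (k ^ (2 / α))⁻¹ * upperGamma (2 / α) (k * r ^ α) := by
  set s : ℝ := 2 / α with hs
  -- The Gamma integrand, cut off below k r^α, lets the substitution t = k y^α run over the whole
  -- half-line; s = 2/α is the exponent that leaves exactly one factor y.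
  set Hf : ℝ → ℝ := fun t => if k * r ^ α ≤ t then t ^ (s - 1) * Real.exp (-t) else 0 with hHf
  have h1 : ∫ t in Set.Ioi (0 : ℝ), Hf t = upperGamma s (k * r ^ α) := by
    rw [upperGamma, ← integral_Ici_eq_integral_Ioi (x := k * r ^ α),
      ← integral_indicator measurableSet_Ioi,
      ← integral_indicator measurableSet_Ici]
    congr 1
    ext t
    simp only [hHf, Set.indicator_apply, Set.mem_Ioi, Set.mem_Ici]
    by_cases ht : k * r ^ α ≤ t
    · have : 0 < t := lt_of_lt_of_le (by positivity) ht
      simp [ht, this]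
    · simp [ht]
  have h2 : ∫ t in Set.Ioi (0 : ℝ), Hf (k * t) = k⁻¹ * upperGamma s (k * r ^ α) := by
    rw [integral_comp_mul_left_Ioi Hf 0 hk, mul_zero, h1, smul_eq_mul]
  have h3 := integral_comp_rpow_Ioi_of_pos (g := fun t => Hf (k * t)) hα
  rw [h2] at h3
  have h4 : ∫ y in Set.Ioi (0 : ℝ), (α * y ^ (α - 1)) • Hf (k * y ^ α)
      = ∫ y in Set.Ioi (0 : ℝ), (α * k ^ (s - 1)) *
          (y * (if r ≤ y then Real.exp (-(k * y ^ α)) else 0)) := by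
    refine setIntegral_congr_fun measurableSet_Ioi fun y hy => ?_
    have hy' : 0 < y := hy
    have hiff : k * r ^ α ≤ k * y ^ α ↔ r ≤ y := by
      rw [mul_le_mul_iff_right₀ hk, Real.rpow_le_rpow_iff hr.le hy'.le hα]
    simp only [hHf, hiff, smul_eq_mul]
    split_ifs
    · rw [Real.mul_rpow hk.le (by positivity), ← Real.rpow_mul hy'.le]
      have : y ^ (α - 1) * y ^ (α * (s - 1)) = y := by
        rw [← Real.rpow_add hy']
        have : α - 1 + α * (s - 1) = 1 := by rw [hs]; field_simp; ring
        rw [this, Real.rpow_one]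
      linear_combination (α * k ^ (s - 1) * Real.exp (-(k * y ^ α))) * this
    · simp
  rw [h4, integral_const_mul] at h3
  have hks : k ^ (s - 1) = k ^ s * k⁻¹ := by
    rw [Real.rpow_sub_one hk.ne', div_eq_mul_inv]
  have hkp : 0 < k ^ s := by positivity
  rw [hks] at h3
  field_simp at h3 ⊢
  linarith

end Integrals

section Eavesdroppers

/-! ### The strongest eavesdropper -/

/-! ### Independent marking of a sequence of random points -/

section Marking

variable {Ω : Type*} [MeasurableSpace Ω] {μ : Measure Ω} [IsProbabilityMeasure μ]
  {E F : Type*} [MeasurableSpace E] [MeasurableSpace F] {X : ℕ → Ω → E} {G : ℕ → Ω → F}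
  {ν : Measure F} [IsProbabilityMeasure ν]

/-- Avoidance probability of finitely many independently marked points. -/
lemma measure_forall_lt_marked_notMem (hX : ∀ j, Measurable (X j)) (hG : ∀ j, Measurable (G j))
    (hlaw : ∀ j, μ.map (G j) = ν) (hind : iIndepFun G μ)
    (hXG : IndepFun (fun ω j => X j ω) (fun ω j => G j ω) μ) {A : Set (E × F)}
    (hA : MeasurableSet A) (N : ℕ) :
    μ {ω | ∀ j < N, (X j ω, G j ω) ∉ A}
      = ∫⁻ ω, ∏ j ∈ Finset.range N, (1 - ν (Prod.mk (X j ω) ⁻¹' A)) ∂μ := by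
  have hXm : Measurable fun ω (j : Fin N) => X j ω := measurable_pi_lambda _ fun j => hX j
  have hGm : Measurable fun ω (j : Fin N) => G j ω := measurable_pi_lambda _ fun j => hG j
  have hind' : IndepFun (fun ω (j : Fin N) => X j ω) (fun ω (j : Fin N) => G j ω) μ :=
    hXG.comp (φ := fun (x : ℕ → E) (j : Fin N) => x j) (ψ := fun (x : ℕ → F) (j : Fin N) => x j)
      (measurable_pi_lambda _ fun j => measurable_pi_apply _)
      (measurable_pi_lambda _ fun j => measurable_pi_apply _)
  have hprod := (indepFun_iff_map_prod_eq_prod_map_map hXm.aemeasurable hGm.aemeasurable).1 hind'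
  have hpi : μ.map (fun ω (j : Fin N) => G j ω) = Measure.pi fun _ => ν := by
    have := (iIndepFun_iff_map_fun_eq_pi_map (fun j : Fin N => (hG j).aemeasurable)).1
      (hind.precomp Fin.val_injective)
    rw [this]
    simp_rw [hlaw]
  set S : Set ((Fin N → E) × (Fin N → F)) := {p | ∀ j, (p.1 j, p.2 j) ∉ A} with hS
  have hSm : MeasurableSet S := by
    have : S = ⋂ j, (fun p : (Fin N → E) × (Fin N → F) => (p.1 j, p.2 j)) ⁻¹' Aᶜ := by
      ext p; simp [hS]
    rw [this]
    exact MeasurableSet.iInter fun j => by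
      refine (Measurable.prodMk ?_ ?_) hA.compl
      · exact (measurable_pi_apply j).comp measurable_fst
      · exact (measurable_pi_apply j).comp measurable_snd
  have h1 : {ω | ∀ j < N, (X j ω, G j ω) ∉ A}
      = (fun ω => ((fun j : Fin N => X j ω), (fun j : Fin N => G j ω))) ⁻¹' S := by
    ext ω
    simp [hS, Fin.forall_iff]
  rw [h1, ← Measure.map_apply (hXm.prodMk hGm) hSm, hprod, Measure.prod_apply hSm,
    lintegral_map (measurable_measure_prodMk_left hSm) hXm]
  refine lintegral_congr fun ω => ?_
  -- With the positions frozen, avoidance constrains each mark separately: the section is a box, and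
  -- the product law of the marks factors over it.
  have h2 : Prod.mk (fun j : Fin N => X j ω) ⁻¹' S
      = Set.univ.pi fun j : Fin N => (Prod.mk (X j ω) ⁻¹' A)ᶜ := by
    ext g; simp [hS]
  rw [h2, hpi, Measure.pi_pi, Finset.prod_range (fun j => 1 - ν (Prod.mk (X j ω) ⁻¹' A))]
  exact Finset.prod_congr rfl fun j _ => prob_compl_eq_one_sub (measurable_prodMk_left hA)

/-- Avoidance probability of a sequence of independently marked points. -/
lemma measure_forall_marked_notMem (hX : ∀ j, Measurable (X j)) (hG : ∀ j, Measurable (G j))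
    (hlaw : ∀ j, μ.map (G j) = ν) (hind : iIndepFun G μ)
    (hXG : IndepFun (fun ω j => X j ω) (fun ω j => G j ω) μ) {A : Set (E × F)}
    (hA : MeasurableSet A) :
    μ {ω | ∀ j, (X j ω, G j ω) ∉ A}
      = ∫⁻ ω, ⨅ N, ∏ j ∈ Finset.range N, (1 - ν (Prod.mk (X j ω) ⁻¹' A)) ∂μ := by
  have h1 : {ω | ∀ j, (X j ω, G j ω) ∉ A} = ⋂ N : ℕ, {ω | ∀ j < N, (X j ω, G j ω) ∉ A} := by
    ext ω
    simp only [Set.mem_ofPred_eq, Set.mem_iInter]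
    exact ⟨fun h N j _ => h j, fun h j => h (j + 1) j (Nat.lt_succ_self j)⟩
  have hm : ∀ N : ℕ, MeasurableSet {ω | ∀ j < N, (X j ω, G j ω) ∉ A} := by
    intro N
    have : {ω | ∀ j < N, (X j ω, G j ω) ∉ A} = ⋂ j, ⋂ (_ : j < N), (fun ω => (X j ω, G j ω)) ⁻¹' Aᶜ := by
      ext ω; simp
    rw [this]
    exact MeasurableSet.iInter fun j => MeasurableSet.iInter fun _ =>
      ((hX j).prodMk (hG j)) hA.compl
  have hanti : Antitone fun N : ℕ => {ω | ∀ j < N, (X j ω, G j ω) ∉ A} :=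
    fun m n hmn ω hω j hj => hω j (hj.trans_le hmn)
  rw [h1, hanti.measure_iInter (fun N => (hm N).nullMeasurableSet) ⟨0, measure_ne_top _ _⟩,
    lintegral_iInf]
  · exact iInf_congr fun N => measure_forall_lt_marked_notMem hX hG hlaw hind hXG hA N
  · intro N
    refine Finset.measurable_prod _ fun j _ => measurable_const.sub ?_
    exact (measurable_measure_prodMk_left hA).comp (hX j)
  · exact fun m n hmn ω => antitone_prod_range (fun j => tsub_le_self) hmn
  · simp

end Marking

/-! ### Distribution function and density of the strongest eavesdropper's SNR -/

namespace Params

variable (P : Params)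

lemma δ_pos : 0 < P.δ := div_pos two_pos P.α_pos

lemma ρe_mul_a_pos : 0 < P.ρe * P.a := mul_pos P.ρe_pos P.a_pos

lemma ρb_mul_a_pos : 0 < P.ρb * P.a := mul_pos P.ρb_pos P.a_pos

lemma μ₁_pos : 0 < P.μ₁ :=
  mul_pos (mul_pos (mul_pos P.δ_pos Real.pi_pos) P.lam_pos) (Real.rpow_pos_of_pos P.ρe_mul_a_pos _)

lemma μ₂_pos : 0 < P.μ₂ := div_pos (Real.rpow_pos_of_pos P.rp_pos _) P.ρe_mul_a_pos

/-- Distribution function of the SNR of the most detrimental eavesdropper. -/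
def eveCDF (x : ℝ) : ℝ := Real.exp (-(P.μ₁ * upperGamma P.δ (P.μ₂ * x) / x ^ P.δ))

variable {P} {Ω : Type*} [MeasurableSpace Ω] {μ : Measure Ω}
  {U : Fin P.M → Ω → Plane} {H : Fin P.M → Ω → ℂ} {X : ℕ → Ω → Plane} {G : ℕ → Ω → ℂ}

/-- Rewrites a bound on the supremum as avoidance of a fixed set by the marked points, the form to
which the generating functional applies. -/
lemma eveSNR_le_iff {Ω : Type*} {X : ℕ → Ω → Plane} {G : ℕ → Ω → ℂ} {x : ℝ} (hx : 0 ≤ x)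
    (ω : Ω) :
    P.eveSNR X G ω ≤ ENNReal.ofReal x ↔
      ∀ j, ¬ (P.rp ≤ ‖X j ω‖ ∧ x / (P.ρe * P.a) * ‖X j ω‖ ^ P.α < ‖G j ω‖ ^ 2) := by
  have hc := P.ρe_mul_a_pos
  have hdiv : ENNReal.ofReal x / ENNReal.ofReal (P.ρe * P.a)
      = ENNReal.ofReal (x / (P.ρe * P.a)) := (ENNReal.ofReal_div_of_pos hc).symm
  rw [eveSNR, mul_comm, ← ENNReal.le_div_iff_mul_le (Or.inl (by simpa using hc))
    (Or.inl ENNReal.ofReal_ne_top), hdiv, iSup_le_iff]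
  refine forall_congr' fun j => ?_
  rw [iSup_le_iff, not_and, not_lt]
  refine imp_congr_right fun hj => ?_
  have : 0 < ‖X j ω‖ ^ P.α := Real.rpow_pos_of_pos (P.rp_pos.trans_le hj) _
  rw [ENNReal.ofReal_le_ofReal_iff (by positivity), mul_one_div, div_le_iff₀ this]

lemma measurable_eveSNR (hX : ∀ j, Measurable (X j)) (hG : ∀ j, Measurable (G j)) :
    Measurable (P.eveSNR X G) := by
  refine measurable_const.mul (Measurable.iSup fun j => ?_)
  have : (fun ω => ⨆ (_ : P.rp ≤ ‖X j ω‖), ENNReal.ofReal (‖G j ω‖ ^ 2 * (1 / ‖X j ω‖ ^ P.α)))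
      = Set.indicator {ω | P.rp ≤ ‖X j ω‖}
        (fun ω => ENNReal.ofReal (‖G j ω‖ ^ 2 * (1 / ‖X j ω‖ ^ P.α))) := by
    ext ω
    by_cases hω : P.rp ≤ ‖X j ω‖ <;> simp [hω]
  rw [this]
  refine Measurable.indicator ?_ (measurableSet_le measurable_const (hX j).norm)
  exact (((hG j).norm.pow_const 2).mul
    (measurable_const.div ((hX j).norm.pow_const _))).ennreal_ofReal

/-- Given the positions, an eavesdropper at u exceeds the level x with probability `gr ‖u‖`. The
generating functional turns the avoidance probability into exp(-λ ∫ gr), and the radial integral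
produces the incomplete Gamma function. -/
lemma IsNetwork.measure_eveSNR_le [IsProbabilityMeasure μ] (h : P.IsNetwork μ U H X G) {x : ℝ}
    (hx : 0 < x) :
    μ {ω | P.eveSNR X G ω ≤ ENNReal.ofReal x} = ENNReal.ofReal (P.eveCDF x) := by
  have hc := P.ρe_mul_a_pos
  set k : ℝ := x / (P.ρe * P.a) with hk
  have hkpos : 0 < k := div_pos hx hc
  set A : Set (Plane × ℂ) := {p | P.rp ≤ ‖p.1‖ ∧ k * ‖p.1‖ ^ P.α < ‖p.2‖ ^ 2} with hA
  have hAm : MeasurableSet A :=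
    (measurableSet_le (f := fun _ : Plane × ℂ => P.rp) (g := fun p => ‖p.1‖)
      measurable_const (by fun_prop)).inter
      (measurableSet_lt (f := fun p : Plane × ℂ => k * ‖p.1‖ ^ P.α) (g := fun p => ‖p.2‖ ^ 2)
        (by fun_prop) (by fun_prop))
  set gr : ℝ → ℝ := fun y => if P.rp ≤ y then Real.exp (-(k * y ^ P.α)) else 0 with hgr
  have hsec : ∀ u : Plane, stdComplexGaussian (Prod.mk u ⁻¹' A) = ENNReal.ofReal (gr ‖u‖) := by
    intro u
    by_cases hu : P.rp ≤ ‖u‖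
    · have : Prod.mk u ⁻¹' A = {z : ℂ | k * ‖u‖ ^ P.α < ‖z‖ ^ 2} := by
        ext z; simp [hA, hu]
      rw [this, stdComplexGaussian_tail (by positivity)]
      simp [hgr, hu]
    · have : Prod.mk u ⁻¹' A = ∅ := by ext z; simp [hA, hu]
      simp [this, hgr, hu]
  have hgr0 : ∀ y, 0 ≤ gr y := fun y => by
    simp only [hgr]; split_ifs <;> positivity
  have hval : ∫ u : Plane, gr ‖u‖
      = 2 * Real.pi * (P.α⁻¹ * (k ^ P.δ)⁻¹ * upperGamma P.δ (P.μ₂ * x)) := by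
    rw [integral_plane_norm gr, integral_Ioi_exp_neg_rpow P.α_pos hkpos P.rp_pos]
    have : k * P.rp ^ P.α = P.μ₂ * x := by rw [hk, μ₂]; ring
    rw [this]; rfl
  have hγ := upperGamma_pos P.δ_pos (mul_pos P.μ₂_pos hx).le
  have hαpos := P.α_pos
  -- The Bochner integral of a non-integrable function is 0 by convention, so the positive value
  -- just computed forces integrability.
  have hint : Integrable fun u : Plane => gr ‖u‖ := by
    refine Integrable.of_integral_ne_zero ?_
    rw [hval]
    positivity
  have hlint : ∫⁻ u : Plane, ENNReal.ofReal (gr ‖u‖) = ENNReal.ofReal (∫ u : Plane, gr ‖u‖) :=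
    (ofReal_integral_eq_lintegral_ofReal hint (ae_of_all _ fun u => hgr0 _)).symm
  have h1 : {ω | P.eveSNR X G ω ≤ ENNReal.ofReal x} = {ω | ∀ j, (X j ω, G j ω) ∉ A} := by
    ext ω
    exact eveSNR_le_iff hx.le ω
  rw [h1, measure_forall_marked_notMem h.ppp.measurable h.measurable_G (fun j => (h.law_G j).map_eq)
    h.indep_G h.indep_XG hAm]
  have hmeas : Measurable fun u : Plane => stdComplexGaussian (Prod.mk u ⁻¹' A) :=
    measurable_measure_prodMk_left hAm
  rw [h.ppp.lintegral_iInf_prod P.lam_pos.le hmeas (fun u => prob_le_one)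
    (by simp_rw [hsec]; rw [hlint]; exact ENNReal.ofReal_ne_top)]
  simp_rw [hsec]
  rw [hlint, ENNReal.toReal_ofReal (integral_nonneg fun u => hgr0 _), hval, eveCDF, μ₁]
  -- What remains is that λ · 2π / α · k^(-δ) equals δπλ (ρ_e a)^δ / x^δ, since δ = 2/α and k = x /
  -- (ρ_e a).
  congr 3
  rw [hk, Real.div_rpow hx.le hc.le, δ]
  have : 0 < x ^ (2 / P.α) := by positivity
  have : 0 < (P.ρe * P.a) ^ (2 / P.α) := by positivity
  field_simp

lemma evePDF_nonneg {x : ℝ} (hx : 0 < x) : 0 ≤ P.evePDF x := by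
  have h1 := P.μ₁_pos
  have h2 := P.μ₂_pos
  have h3 := P.δ_pos
  have := upperGamma_pos P.δ_pos (mul_pos P.μ₂_pos hx).le
  unfold evePDF
  positivity

lemma hasDerivAt_eveCDF {x : ℝ} (hx : 0 < x) : HasDerivAt P.eveCDF (P.evePDF x) x := by
  have hμ₂ := P.μ₂_pos
  have hxδ : 0 < x ^ P.δ := Real.rpow_pos_of_pos hx _
  have h1 : HasDerivAt (fun x => upperGamma P.δ (P.μ₂ * x))
      (-((P.μ₂ * x) ^ (P.δ - 1) * Real.exp (-(P.μ₂ * x))) * (P.μ₂ * 1)) x :=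
    (hasDerivAt_upperGamma P.δ_pos (mul_pos hμ₂ hx)).comp x ((hasDerivAt_id x).const_mul P.μ₂)
  have h2 := Real.hasDerivAt_rpow_const (p := P.δ) (Or.inl hx.ne')
  refine (((h1.const_mul P.μ₁).div h2 hxδ.ne').neg.exp).congr_deriv ?_
  simp only [Pi.neg_apply, Pi.div_apply]
  rw [evePDF, Real.rpow_sub_one (mul_pos hμ₂ hx).ne', Real.rpow_sub_one hx.ne',
    Real.rpow_add_one hx.ne', Real.mul_rpow hμ₂.le hx.le]
  field_simp
  ring

lemma tendsto_eveCDF_atTop : Filter.Tendsto P.eveCDF Filter.atTop (nhds 1) := by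
  have hb : Filter.Tendsto (fun x : ℝ => P.μ₁ * upperGamma P.δ (P.μ₂ * x) / x ^ P.δ)
      Filter.atTop (nhds 0) := by
    have h0 : Filter.Tendsto (fun x : ℝ => P.μ₁ * upperGamma P.δ 0 / x ^ P.δ) Filter.atTop
        (nhds 0) := (tendsto_rpow_atTop P.δ_pos).const_div_atTop _
    refine squeeze_zero' ?_ ?_ h0
    · filter_upwards [Filter.eventually_gt_atTop 0] with x hx
      have := upperGamma_pos P.δ_pos (mul_pos P.μ₂_pos hx).le
      have := P.μ₁_pos
      positivity
    · filter_upwards [Filter.eventually_gt_atTop 0] with x hx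
      have := P.μ₁_pos
      have := upperGamma_antitone P.δ_pos le_rfl (mul_pos P.μ₂_pos hx).le
      gcongr
  have := (Real.continuous_exp.tendsto _).comp hb.neg
  rw [neg_zero, Real.exp_zero] at this
  exact this

/-- For x ≤ 1 the Gamma factor stays above Γ(δ, μ₂) > 0 while x^(-δ) blows up, so the exponent tends
to -∞: there is no atom at 0. -/
lemma tendsto_eveCDF_zero : Filter.Tendsto P.eveCDF (nhdsWithin 0 (Set.Ioi 0)) (nhds 0) := by
  refine Real.tendsto_exp_atBot.comp (Filter.tendsto_neg_atTop_atBot.comp ?_)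
  have hγ := upperGamma_pos P.δ_pos P.μ₂_pos.le
  have hlow : Filter.Tendsto (fun x : ℝ => P.μ₁ * upperGamma P.δ P.μ₂ * (x ^ P.δ)⁻¹)
      (nhdsWithin 0 (Set.Ioi 0)) Filter.atTop := by
    refine Filter.Tendsto.const_mul_atTop (mul_pos P.μ₁_pos hγ) ?_
    refine Filter.Tendsto.inv_tendsto_nhdsGT_zero ?_
    refine tendsto_nhdsWithin_iff.2 ⟨?_, ?_⟩
    · have := (Real.continuousAt_rpow_const 0 P.δ (Or.inr P.δ_pos.le)).tendsto
      rw [Real.zero_rpow P.δ_pos.ne'] at this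
      exact this.mono_left nhdsWithin_le_nhds
    · filter_upwards [self_mem_nhdsWithin] with x hx
      exact Real.rpow_pos_of_pos hx _
  refine Filter.tendsto_atTop_mono' _ ?_ hlow
  filter_upwards [self_mem_nhdsWithin, nhdsWithin_le_nhds (Iic_mem_nhds one_pos)] with x hx hx1
  have hx : 0 < x := hx
  have hx1 : x ≤ 1 := hx1
  have h1 := upperGamma_antitone P.δ_pos (mul_pos P.μ₂_pos hx).le
    (mul_le_of_le_one_right P.μ₂_pos.le hx1)
  have := P.μ₁_pos
  rw [← div_eq_mul_inv]
  gcongr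

/-- At 0 the convention a / 0 = 0 gives `eveCDF` the value 1 instead of its limit 0. The indicator
corrects this, so that the fundamental theorem of calculus can start at 0. -/
lemma continuousWithinAt_eveCDF_indicator :
    ContinuousWithinAt ((Set.Ioi 0).indicator P.eveCDF) (Set.Ici 0) 0 := by
  rw [← continuousWithinAt_Ioi_iff_Ici, ContinuousWithinAt]
  simp only [Set.mem_Ioi, lt_self_iff_false, not_false_eq_true, Set.indicator_of_notMem]
  refine (tendsto_eveCDF_zero (P := P)).congr' ?_
  filter_upwards [self_mem_nhdsWithin] with x hx
  rw [Set.indicator_of_mem hx]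

lemma hasDerivAt_eveCDF_indicator {x : ℝ} (hx : 0 < x) :
    HasDerivAt ((Set.Ioi 0).indicator P.eveCDF) (P.evePDF x) x := by
  refine (hasDerivAt_eveCDF hx).congr_of_eventuallyEq ?_
  filter_upwards [lt_mem_nhds hx] with y hy
  rw [Set.indicator_of_mem (Set.mem_Ioi.2 hy)]

lemma tendsto_eveCDF_indicator :
    Filter.Tendsto ((Set.Ioi 0).indicator P.eveCDF) Filter.atTop (nhds 1) := by
  refine (tendsto_eveCDF_atTop (P := P)).congr' ?_
  filter_upwards [Filter.eventually_gt_atTop 0] with x hx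
  rw [Set.indicator_of_mem (Set.mem_Ioi.2 hx)]

lemma integrableOn_evePDF : IntegrableOn P.evePDF (Set.Ioi 0) :=
  integrableOn_Ioi_deriv_of_nonneg continuousWithinAt_eveCDF_indicator
    (fun _ hx => hasDerivAt_eveCDF_indicator hx) (fun _ hx => evePDF_nonneg hx)
    tendsto_eveCDF_indicator

lemma integral_evePDF : ∫ x in Set.Ioi (0 : ℝ), P.evePDF x = 1 := by
  rw [integral_Ioi_of_hasDerivAt_of_nonneg continuousWithinAt_eveCDF_indicator
    (fun _ hx => hasDerivAt_eveCDF_indicator hx) (fun _ hx => evePDF_nonneg hx)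
    tendsto_eveCDF_indicator]
  simp

lemma integral_Ioi_evePDF {a : ℝ} (ha : 0 < a) :
    ∫ x in Set.Ioi a, P.evePDF x = 1 - P.eveCDF a :=
  integral_Ioi_of_hasDerivAt_of_nonneg (hasDerivAt_eveCDF ha).continuousAt.continuousWithinAt
    (fun _ hx => hasDerivAt_eveCDF (ha.trans hx)) (fun _ hx => evePDF_nonneg (ha.trans hx))
    tendsto_eveCDF_atTop

lemma integral_Ioc_evePDF {a : ℝ} (ha : 0 < a) :
    ∫ x in Set.Ioc 0 a, P.evePDF x = P.eveCDF a := by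
  have h := setIntegral_union (μ := volume) (f := P.evePDF)
    (Set.Ioc_disjoint_Ioi (le_refl a)) measurableSet_Ioi
    (integrableOn_evePDF.mono_set Set.Ioc_subset_Ioi_self)
    (integrableOn_evePDF.mono_set (Set.Ioi_subset_Ioi ha.le))
  rw [Set.Ioc_union_Ioi_eq_Ioi ha.le, integral_evePDF, integral_Ioi_evePDF ha] at h
  linarith

/-- The law on `(0, ∞)` with density `evePDF`. -/
def eveLaw (P : Params) : Measure ℝ :=
  (volume.restrict (Set.Ioi (0 : ℝ))).withDensity (fun x => ENNReal.ofReal (P.evePDF x))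

lemma eveLaw_apply {s : Set ℝ} (hs : MeasurableSet s) :
    P.eveLaw s = ENNReal.ofReal (∫ x in s ∩ Set.Ioi 0, P.evePDF x) := by
  rw [eveLaw, withDensity_apply _ hs, Measure.restrict_restrict hs,
    ofReal_integral_eq_lintegral_ofReal (integrableOn_evePDF.mono_set Set.inter_subset_right)]
  filter_upwards [ae_restrict_mem (hs.inter measurableSet_Ioi)] with x hx
  exact evePDF_nonneg hx.2

instance : IsProbabilityMeasure P.eveLaw :=
  ⟨by rw [eveLaw_apply MeasurableSet.univ, Set.univ_inter, integral_evePDF, ENNReal.ofReal_one]⟩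

/-- Two probability measures on [0, ∞] agree once they agree on lower rays. The right-hand side has
no mass at ⊤, so almost sure finiteness is part of the equality. -/
lemma IsNetwork.map_eveSNR [IsProbabilityMeasure μ] (h : P.IsNetwork μ U H X G) :
    μ.map (P.eveSNR X G) = P.eveLaw.map ENNReal.ofReal := by
  have hm := measurable_eveSNR (P := P) h.ppp.measurable h.measurable_G
  have := Measure.isProbabilityMeasure_map (μ := μ) hm.aemeasurable
  have := Measure.isProbabilityMeasure_map (μ := P.eveLaw)
    ENNReal.measurable_ofReal.aemeasurable
  refine Measure.ext_of_Iic _ _ fun a => ?_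
  induction a with
  | top => simp
  | coe a =>
    rw [Measure.map_apply hm measurableSet_Iic,
      Measure.map_apply ENNReal.measurable_ofReal measurableSet_Iic,
      eveLaw_apply (ENNReal.measurable_ofReal measurableSet_Iic)]
    have hpre : ENNReal.ofReal ⁻¹' Set.Iic (a : ENNReal) ∩ Set.Ioi 0 = Set.Ioc 0 (a : ℝ) := by
      ext x
      simp only [Set.mem_inter_iff, Set.mem_preimage, Set.mem_Iic, Set.mem_Ioi, Set.mem_Ioc,
        and_comm (a := ENNReal.ofReal x ≤ a)]
      refine and_congr_right fun hx => ?_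
      rw [← ENNReal.ofReal_coe_nnreal, ENNReal.ofReal_le_ofReal_iff a.coe_nonneg]
    rw [hpre]
    rcases eq_or_lt_of_le a.2 with ha | ha
    -- The formula for the distribution function is available only at positive levels; the atom at 0
    -- is excluded by letting the level decrease to 0.
    · have ha : (0 : ℝ) = (a : ℝ) := ha
      have ha0 : (a : ENNReal) = 0 := by
        rw [← ENNReal.ofReal_coe_nnreal, ← ha, ENNReal.ofReal_zero]
      rw [← ha, Set.Ioc_self, setIntegral_empty, ENNReal.ofReal_zero, ha0]
      have hlim : Filter.Tendsto (fun x => ENNReal.ofReal (P.eveCDF x))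
          (nhdsWithin 0 (Set.Ioi 0)) (nhds 0) := by
        rw [← ENNReal.ofReal_zero]
        exact ENNReal.tendsto_ofReal tendsto_eveCDF_zero
      refine le_antisymm (ge_of_tendsto hlim ?_) zero_le
      filter_upwards [self_mem_nhdsWithin] with x hx
      rw [← h.measure_eveSNR_le hx]
      refine measure_mono fun ω hω => ?_
      exact (show P.eveSNR X G ω ≤ 0 from hω).trans zero_le
    · have ha : (0 : ℝ) < (a : ℝ) := ha
      rw [integral_Ioc_evePDF ha, ← h.measure_eveSNR_le ha, ENNReal.ofReal_coe_nnreal]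
      rfl

end Params

end Eavesdroppers

section OrderStatistics

/-! ### Quadrature -/

/-- Midpoint Riemann sums of a continuous function converge. -/
lemma tendsto_midpoint_sum {w : ℝ → ℝ} (hw : Continuous w) {L : ℝ} (hL : 0 < L) :
    Filter.Tendsto (fun K : ℕ => ∑ j ∈ Finset.range K,
      L / K * w ((2 * (j : ℝ) + 1) / (2 * K) * L)) Filter.atTop
      (nhds (∫ θ in (0 : ℝ)..L, w θ)) := by
  rw [Metric.tendsto_atTop]
  intro ε hε
  have huc : UniformContinuousOn w (Set.Icc 0 L) :=
    isCompact_Icc.uniformContinuousOn_of_continuous hw.continuousOn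
  -- Oscillation ε / (2L) over total length L gives a total error of at most ε / 2; taking K > L / η
  -- makes the mesh finer than η.
  obtain ⟨η, hη, hwη⟩ := Metric.uniformContinuousOn_iff.1 huc (ε / (2 * L)) (by positivity)
  obtain ⟨N, hN⟩ := exists_nat_gt (L / η)
  refine ⟨max N 1, fun K hK => ?_⟩
  have hK1 : 1 ≤ K := (le_max_right _ _).trans hK
  have hKpos : (0 : ℝ) < K := by exact_mod_cast hK1
  have hKη : L / K < η := by
    rw [div_lt_iff₀ hKpos]
    rw [div_lt_iff₀ hη] at hN
    have : (N : ℝ) ≤ K := by exact_mod_cast (le_max_left _ _).trans hK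
    nlinarith
  have hadj : ∑ j ∈ Finset.range K, ∫ θ in ((j : ℝ) * (L / K))..(((j + 1 : ℕ) : ℝ) * (L / K)), w θ
      = ∫ θ in (0 : ℝ)..L, w θ := by
    rw [intervalIntegral.sum_integral_adjacent_intervals (a := fun j : ℕ => (j : ℝ) * (L / K))
      (fun j _ => hw.intervalIntegrable _ _)]
    congr 1
    · simp
    · field_simp
  have hcell : ∀ j ∈ Finset.range K,
      |L / K * w ((2 * (j : ℝ) + 1) / (2 * K) * L)
        - ∫ θ in ((j : ℝ) * (L / K))..(((j + 1 : ℕ) : ℝ) * (L / K)), w θ|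
      ≤ ε / (2 * L) * (L / K) := by
    intro j hj
    have hjK : (j : ℝ) + 1 ≤ K := by exact_mod_cast Finset.mem_range.1 hj
    have hlen : ((j + 1 : ℕ) : ℝ) * (L / K) - (j : ℝ) * (L / K) = L / K := by push_cast; ring
    set m : ℝ := (2 * (j : ℝ) + 1) / (2 * K) * L with hm
    have hm' : m = (j : ℝ) * (L / K) + L / K / 2 := by rw [hm]; field_simp
    have hh : 0 < L / K := by positivity
    have hright : ((j + 1 : ℕ) : ℝ) * (L / K) ≤ L := by
      push_cast
      calc ((j : ℝ) + 1) * (L / K) ≤ K * (L / K) := by gcongr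
        _ = L := by field_simp
    have hleft : 0 ≤ (j : ℝ) * (L / K) := by positivity
    have hconst : L / K * w m
        = ∫ _ in ((j : ℝ) * (L / K))..(((j + 1 : ℕ) : ℝ) * (L / K)), w m := by
      rw [intervalIntegral.integral_const, hlen, smul_eq_mul]
    rw [hconst, ← intervalIntegral.integral_sub (intervalIntegrable_const)
      (hw.intervalIntegrable _ _), ← Real.norm_eq_abs]
    have hbd := intervalIntegral.norm_integral_le_of_norm_le_const
      (a := (j : ℝ) * (L / K)) (b := ((j + 1 : ℕ) : ℝ) * (L / K)) (C := ε / (2 * L))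
      (f := fun θ => w m - w θ) ?_
    · rwa [hlen, abs_of_pos hh] at hbd
    · intro θ hθ
      rw [Set.uIoc_of_le (by linarith)] at hθ
      have h1 := hθ.1
      have h2 := hθ.2
      have h3 : ((j + 1 : ℕ) : ℝ) * (L / K) = (j : ℝ) * (L / K) + L / K := by linarith
      refine (hwη m ⟨by linarith, by linarith⟩ θ ⟨by linarith, by linarith⟩ ?_).le
      rw [Real.dist_eq, abs_lt]
      constructor <;> linarith
  rw [← hadj, Real.dist_eq, ← Finset.sum_sub_distrib]
  calc _ ≤ ∑ j ∈ Finset.range K, ε / (2 * L) * (L / K) :=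
        (Finset.abs_sum_le_sum_abs _ _).trans (Finset.sum_le_sum hcell)
    _ = ε / 2 := by
        rw [Finset.sum_const, Finset.card_range, nsmul_eq_mul]; field_simp
    _ < ε := by linarith

/-! ### Order statistics -/

open Polynomial in
/-- The upper tail of a binomial law as an incomplete Beta integral. -/
lemma sum_bernsteinPolynomial_tail (ν d : ℕ) :
    ∑ i ∈ Finset.range (d + 1), bernsteinPolynomial ℝ (ν + d + 1) (ν + i + 1)
      = C (((ν + d + 1 : ℕ) : ℝ) * (ν + d).choose ν) * ∑ p ∈ Finset.range (d + 1),
          C ((d.choose p : ℝ) * ((-1) ^ p / ((ν + 1 : ℕ) + p : ℝ))) * X ^ (ν + p + 1) := by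
  set A := ∑ i ∈ Finset.range (d + 1), bernsteinPolynomial ℝ (ν + d + 1) (ν + i + 1) with hA
  set B := C (((ν + d + 1 : ℕ) : ℝ) * (ν + d).choose ν) * ∑ p ∈ Finset.range (d + 1),
          C ((d.choose p : ℝ) * ((-1) ^ p / ((ν + 1 : ℕ) + p : ℝ))) * X ^ (ν + p + 1) with hB
  -- Both sides vanish at 0, so comparing derivatives suffices. Here the derivatives of the
  -- Bernstein polynomials telescope to a single term; for `B` the same term comes from expanding (1
  -- - X)^d.
  have hdA : derivative A = ((ν + d + 1 : ℕ) : ℝ[X]) *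
      (((ν + d).choose ν : ℝ[X]) * X ^ ν * (1 - X) ^ d) := by
    rw [hA, derivative_sum]
    simp_rw [bernsteinPolynomial.derivative_succ, Nat.add_sub_cancel]
    rw [← Finset.mul_sum]
    have := Finset.sum_range_sub' (fun i => bernsteinPolynomial ℝ (ν + d) (ν + i)) (d + 1)
    simp only [← add_assoc] at this
    rw [this, bernsteinPolynomial.eq_zero_of_lt ℝ (show ν + d < ν + d + 1 by omega), sub_zero,
      add_zero, bernsteinPolynomial, Nat.add_sub_cancel_left]
  have hdB : derivative B = ((ν + d + 1 : ℕ) : ℝ[X]) *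
      (((ν + d).choose ν : ℝ[X]) * X ^ ν * (1 - X) ^ d) := by
    have hterm : ∀ p ∈ Finset.range (d + 1),
        derivative (C ((d.choose p : ℝ) * ((-1) ^ p / ((ν + 1 : ℕ) + p : ℝ))) * X ^ (ν + p + 1))
          = X ^ ν * ((-X) ^ p * 1 ^ (d - p) * (d.choose p : ℝ[X])) := by
      intro p _
      rw [derivative_C_mul, derivative_X_pow, Nat.add_sub_cancel, neg_pow (X : ℝ[X]) p, one_pow, mul_one,
        ← mul_assoc, ← C_mul]
      have : (d.choose p : ℝ) * ((-1) ^ p / ((ν + 1 : ℕ) + p : ℝ)) * ((ν + p + 1 : ℕ) : ℝ)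
          = (-1) ^ p * d.choose p := by
        have : ((ν : ℝ) + 1 + p) ≠ 0 := by positivity
        push_cast
        rw [show (ν : ℝ) + p + 1 = ν + 1 + p by ring]
        field_simp
      rw [this, C_mul, C_pow, C_neg, C_1, C_eq_natCast]
      ring
    rw [hB, derivative_C_mul, derivative_sum, Finset.sum_congr rfl hterm, ← Finset.mul_sum,
      ← add_pow, C_mul, C_eq_natCast, C_eq_natCast, neg_add_eq_sub]
    ring
  have h0 : derivative (A - B) = 0 := by rw [derivative_sub, hdA, hdB, sub_self]
  have hc := derivative_eq_zero.1 h0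
  have he : (A - B).eval 0 = 0 := by
    rw [eval_sub, hA, hB]
    simp [eval_finsetSum, bernsteinPolynomial]
  rw [eq_C_of_natDegree_eq_zero hc, eval_C] at he
  rw [← sub_eq_zero, eq_C_of_natDegree_eq_zero hc, he, C_0]

namespace Params

variable (P : Params)

/-- Distribution function of the `n`-th order statistic in terms of that of a single variable. -/
def orderPoly (t : ℝ) : ℝ :=
  P.phi * ∑ p ∈ Finset.range (P.M - P.n + 1),
    ((P.M - P.n).choose p : ℝ) * ((-1) ^ p / ((P.n : ℝ) + p)) * t ^ (P.n + p)

lemma continuous_orderPoly : Continuous P.orderPoly := by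
  unfold orderPoly; fun_prop

lemma sum_binomial_tail (t : ℝ) :
    ∑ j ∈ Finset.range (P.M + 1), P.M.choose j •
        (if P.n ≤ j then t ^ j * (1 - t) ^ (P.M - j) else 0) = P.orderPoly t := by
  -- Writing n = ν + 1 and M = ν + d + 1 removes truncated subtraction; in these terms φ_n is M
  -- times the binomial coefficient of M - 1 over n - 1.
  obtain ⟨ν, hν⟩ : ∃ ν, P.n = ν + 1 := ⟨P.n - 1, by have := P.one_le_n; omega⟩
  obtain ⟨d, hd⟩ : ∃ d, P.M = ν + d + 1 := ⟨P.M - P.n, by have := P.n_le_M; omega⟩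
  have h := congrArg (Polynomial.eval t) (sum_bernsteinPolynomial_tail ν d)
  simp only [Polynomial.eval_finsetSum, Polynomial.eval_mul, Polynomial.eval_C,
    Polynomial.eval_pow, Polynomial.eval_X, bernsteinPolynomial, Polynomial.eval_natCast,
    Polynomial.eval_sub, Polynomial.eval_one] at h
  have hMn : P.M - P.n = d := by omega
  have hphi : P.phi = ((ν + d + 1 : ℕ) : ℝ) * (ν + d).choose ν := by
    rw [phi, hMn, hν, hd, Nat.add_sub_cancel, Nat.factorial_succ,
      ← Nat.add_choose_mul_factorial_mul_factorial ν d]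
    have : (ν + d).choose d = (ν + d).choose ν := by
      rw [← Nat.choose_symm_add, add_comm]
    push_cast
    field_simp
    rw [this]
  rw [orderPoly, hphi, hMn]
  have hr : ∀ p, P.n + p = ν + p + 1 := by intro p; omega
  simp_rw [hr, hν]
  rw [← h, hd, show ν + d + 1 + 1 = (ν + 1) + (d + 1) by ring, Finset.sum_range_add,
    Finset.sum_eq_zero, zero_add]
  · refine Finset.sum_congr rfl fun i _ => ?_
    rw [if_pos (by omega), nsmul_eq_mul, show ν + 1 + i = ν + i + 1 by ring, mul_assoc]
  · intro i hi
    rw [if_neg (by have := Finset.mem_range.1 hi; omega), smul_zero]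

lemma orderStat_mem_range (v : Fin P.M → ℝ) : P.orderStat v ∈ Set.range v := ⟨_, rfl⟩

/-- If the value at sorted position n - 1 (counted from 0) is at most x, then so are the n values up
to it; otherwise only the n - 1 values strictly before it can be. -/
lemma orderStat_le_iff (v : Fin P.M → ℝ) (x : ℝ) :
    P.orderStat v ≤ x ↔ P.n ≤ (Finset.univ.filter fun i => v i ≤ x).card := by
  have hn := P.one_le_n
  have hnM := P.n_le_M
  set k : Fin P.M := ⟨P.n - 1, by omega⟩ with hk
  have hmono : Monotone (v ∘ Tuple.sort v) := Tuple.monotone_sort v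
  have hos : P.orderStat v = (v ∘ Tuple.sort v) k := rfl
  constructor
  · intro h
    have hsub : (Finset.Iic k).map (Tuple.sort v).toEmbedding
        ⊆ Finset.univ.filter fun i => v i ≤ x := by
      intro i hi
      obtain ⟨j, hj, rfl⟩ := Finset.mem_map.1 hi
      exact Finset.mem_filter.2 ⟨Finset.mem_univ _,
        (hmono (Finset.mem_Iic.1 hj)).trans (hos ▸ h)⟩
    have := Finset.card_le_card hsub
    rw [Finset.card_map, Fin.card_Iic] at this
    simp only [hk] at this
    omega
  · intro h
    by_contra hlt
    have hlt := not_le.1 hlt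
    have hsub : (Finset.univ.filter fun i => v i ≤ x)
        ⊆ (Finset.Iio k).map (Tuple.sort v).toEmbedding := by
      intro i hi
      refine Finset.mem_map.2 ⟨(Tuple.sort v).symm i, ?_, by simp⟩
      rw [Finset.mem_Iio]
      by_contra hge
      have h1 := hmono (not_lt.1 hge)
      simp only [Function.comp_apply, Equiv.apply_symm_apply] at h1
      rw [hos] at hlt
      exact absurd (h1.trans (Finset.mem_filter.1 hi).2) (not_le.2 hlt)
    have := Finset.card_le_card hsub
    rw [Finset.card_map, Fin.card_Iio] at this
    simp only [hk] at this
    omega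

section

variable {P} {Ω : Type*} [MeasurableSpace Ω] {μ : Measure Ω} [IsProbabilityMeasure μ]

lemma measurable_orderStat {W : Fin P.M → Ω → ℝ} (hW : ∀ i, Measurable (W i)) :
    Measurable fun ω => P.orderStat fun i => W i ω := by
  refine measurable_of_Iic fun x => ?_
  have : (fun ω => P.orderStat fun i => W i ω) ⁻¹' Set.Iic x
      = {ω | (P.n : ℝ) ≤ ∑ i, {ω | W i ω ≤ x}.indicator (fun _ => (1 : ℝ)) ω} := by
    ext ω
    rw [Set.mem_preimage, Set.mem_Iic, orderStat_le_iff, Finset.card_filter]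
    simp only [Set.mem_ofPred_eq, Set.indicator_apply]
    rw [← Nat.cast_le (α := ℝ)]
    push_cast
    rfl
  rw [this]
  refine measurableSet_le measurable_const (Finset.measurable_sum _ fun i _ => ?_)
  exact measurable_const.indicator (measurableSet_le (hW i) measurable_const)

/-- Distribution function of the `n`-th order statistic of independent variables that share the
probability of not exceeding `x`. -/
lemma measureReal_orderStat_le {W : Fin P.M → Ω → ℝ} (hW : ∀ i, Measurable (W i))
    (hind : iIndepFun W μ) {x F : ℝ} (hF : ∀ i, μ.real {ω | W i ω ≤ x} = F) :
    μ.real {ω | (P.orderStat fun i => W i ω) ≤ x} = P.orderPoly F := by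
  classical
  -- The sample space is partitioned by the exact set S of indices with W_i ≤ x. Independence gives
  -- each piece a probability depending only on |S|, so the sum over S becomes a binomial tail.
  set ev : Finset (Fin P.M) → Set Ω := fun S => {ω | (Finset.univ.filter fun i => W i ω ≤ x) = S}
    with hev
  have hevS : ∀ S, ev S = ⋂ i, W i ⁻¹' (if i ∈ S then Set.Iic x else Set.Ioi x) := by
    intro S
    ext ω
    simp only [hev, Set.mem_ofPred_eq, Finset.ext_iff, Finset.mem_filter, Finset.mem_univ, true_and,
      Set.mem_iInter, Set.mem_preimage]
    refine forall_congr' fun i => ?_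
    by_cases hi : i ∈ S <;> simp [hi]
  have hms : ∀ (S : Finset (Fin P.M)) i,
      MeasurableSet (if i ∈ S then Set.Iic x else Set.Ioi x) := by
    intro S i; split_ifs <;> measurability
  have hevm : ∀ S, MeasurableSet (ev S) := fun S => by
    rw [hevS]; exact MeasurableSet.iInter fun i => hW i (hms S i)
  have hprob : ∀ S, μ.real (ev S) = F ^ S.card * (1 - F) ^ (P.M - S.card) := by
    intro S
    have h1 := hind.measure_inter_preimage_eq_mul (S := Finset.univ)
      (sets := fun i => if i ∈ S then Set.Iic x else Set.Ioi x) (fun i _ => hms S i)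
    have h2 : ∀ i, μ.real (W i ⁻¹' (if i ∈ S then Set.Iic x else Set.Ioi x))
        = if i ∈ S then F else 1 - F := by
      intro i
      split_ifs
      · exact hF i
      · rw [← hF i, ← probReal_compl_eq_one_sub (measurableSet_le (hW i) measurable_const)]
        congr 1
        ext ω; simp
    rw [hevS, Measure.real]
    simp only [Finset.mem_univ, Set.iInter_true] at h1
    rw [h1, ENNReal.toReal_prod]
    change ∏ i, μ.real (W i ⁻¹' (if i ∈ S then Set.Iic x else Set.Ioi x)) = _
    rw [Finset.prod_congr rfl fun i _ => h2 i, Finset.prod_ite, Finset.prod_const,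
      Finset.prod_const]
    have hc1 : (Finset.univ.filter fun i => i ∈ S) = S := by ext; simp
    have hc2 : (Finset.univ.filter fun i => i ∉ S) = Sᶜ := by ext; simp
    rw [hc1, hc2, Finset.card_compl, Fintype.card_fin]
  have hset : {ω | (P.orderStat fun i => W i ω) ≤ x}
      = ⋃ S ∈ (Finset.univ : Finset (Fin P.M)).powerset.filter (fun S => P.n ≤ S.card), ev S := by
    ext ω
    simp only [Set.mem_ofPred_eq, orderStat_le_iff, Set.mem_iUnion, hev]
    constructor
    · intro h
      exact ⟨_, by simpa using h, rfl⟩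
    · rintro ⟨S, hS, rfl⟩
      exact (Finset.mem_filter.1 hS).2
  have hdisj : Set.PairwiseDisjoint
      (((Finset.univ : Finset (Fin P.M)).powerset.filter (fun S => P.n ≤ S.card) : Finset _) :
        Set (Finset (Fin P.M))) ev := by
    intro S _ T _ hST
    refine Set.disjoint_left.2 fun ω hS hT => hST ?_
    exact (show _ = S from hS).symm.trans hT
  rw [hset, measureReal_biUnion_finset hdisj (fun S _ => hevm S), Finset.sum_filter]
  simp_rw [hprob]
  rw [Finset.sum_powerset_apply_card
    (fun j => if P.n ≤ j then F ^ j * (1 - F) ^ (P.M - j) else 0), Finset.card_univ,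
    Fintype.card_fin]
  exact P.sum_binomial_tail F

end

/-- The quadrature approximation of the distribution function of a single gain. -/
def approxGainCDF (K : ℕ) (t : ℝ) : ℝ :=
  ∑ k : Fin (K + 1), coeffB K k * Real.exp (-(P.coeffC K k * t))

lemma prod_coeffB_mul_exp (K : ℕ) (q : Fin (K + 1) → ℕ) (t : ℝ) :
    ∏ k : Fin (K + 1), (coeffB K k * Real.exp (-(P.coeffC K k * t))) ^ q k
      = (∏ k : Fin (K + 1), coeffB K k ^ q k) *
        Real.exp (-∑ k : Fin (K + 1), (q k : ℝ) * P.coeffC K k * t) := by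
  simp_rw [mul_pow]
  rw [Finset.prod_mul_distrib, ← Finset.sum_neg_distrib, Real.exp_sum]
  congr 1
  refine Finset.prod_congr rfl fun k _ => ?_
  rw [← Real.exp_nat_mul]
  congr 1; ring

/-- The multinomial theorem, applied to the powers of the single-gain approximation, produces the
sum over the multi-indices q. -/
lemma approxCDF_eq (K : ℕ) (x : ℝ) :
    P.approxCDF K x = P.orderPoly (P.approxGainCDF K (x / (P.ρb * P.a))) := by
  rw [approxCDF, orderPoly]
  congr 1
  refine Finset.sum_congr rfl fun p _ => ?_
  congr 1
  rw [approxGainCDF, Finset.sum_pow_eq_sum_piAntidiag, indexSet]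
  refine Finset.sum_congr rfl fun q _ => ?_
  rw [prod_coeffB_mul_exp, mul_assoc]

/-- Distribution function of a single gain. -/
def gainCDF (t : ℝ) : ℝ :=
  2 / P.RD ^ 2 * ∫ r in (0 : ℝ)..P.RD, r * (1 - Real.exp (-((1 + r ^ P.α) * t)))

/-- The integrand of the single-gain distribution function after the substitution
`r = R_D / 2 * (cos θ + 1)`. -/
def gainKernel (t θ : ℝ) : ℝ :=
  1 / 2 * Real.sin θ * (Real.cos θ + 1) *
    (1 - Real.exp (-((1 + (P.RD / 2 * (Real.cos θ + 1)) ^ P.α) * t)))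

lemma continuous_gainKernel (t : ℝ) : Continuous (P.gainKernel t) := by
  have h := (Real.continuous_rpow_const P.α_pos.le).comp
    (show Continuous fun θ : ℝ => P.RD / 2 * (Real.cos θ + 1) by fun_prop)
  simp only [Function.comp_def] at h
  unfold gainKernel
  fun_prop

lemma integral_gainKernel (t : ℝ) :
    ∫ θ in (0 : ℝ)..Real.pi, P.gainKernel t θ = P.gainCDF t := by
  have hRD := P.RD_pos.ne'
  set g : ℝ → ℝ := fun r => r * (1 - Real.exp (-((1 + r ^ P.α) * t))) with hg
  have hgc : Continuous g := by
    have h := Real.continuous_rpow_const P.α_pos.le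
    simp only [hg]
    fun_prop
  have hsub := intervalIntegral.integral_comp_mul_deriv (a := 0) (b := Real.pi)
    (f := fun θ : ℝ => P.RD / 2 * (Real.cos θ + 1)) (f' := fun θ => P.RD / 2 * -Real.sin θ)
    (g := g) (fun θ _ => ((Real.hasDerivAt_cos θ).add_const 1).const_mul _) (by fun_prop) hgc
  simp only [Function.comp_apply, Real.cos_zero, Real.cos_pi] at hsub
  -- The substitution is decreasing: θ = 0 corresponds to r = R_D and θ = π to r = 0. The reversed
  -- orientation cancels the sign of -sin θ.
  rw [show P.RD / 2 * (1 + 1) = P.RD by ring, show P.RD / 2 * (-1 + 1) = 0 by ring,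
    intervalIntegral.integral_symm 0 P.RD] at hsub
  rw [gainCDF, show (∫ r in (0 : ℝ)..P.RD, r * (1 - Real.exp (-((1 + r ^ P.α) * t))))
    = -∫ θ in (0 : ℝ)..Real.pi, g (P.RD / 2 * (Real.cos θ + 1)) * (P.RD / 2 * -Real.sin θ) by
      rw [hsub, neg_neg],
    ← intervalIntegral.integral_neg, ← intervalIntegral.integral_const_mul]
  refine intervalIntegral.integral_congr fun θ _ => ?_
  simp only [hg, gainKernel]
  field_simp

/-- The nodes are cosines of the midpoints of K equal cells of [0, π], and √(1 - φ_k²) is the sine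
there. The term k = 0, with c_0 = 0 and b_0 = -∑ b_k, supplies the 1 in each factor 1 - exp(-c_k t).
-/
lemma approxGainCDF_eq (K : ℕ) (t : ℝ) :
    P.approxGainCDF K t = ∑ j ∈ Finset.range K,
      Real.pi / K * P.gainKernel t ((2 * (j : ℝ) + 1) / (2 * K) * Real.pi) := by
  have hIcc : ∑ j ∈ Finset.Icc 1 K, weight K j = ∑ j ∈ Finset.range K, weight K (j + 1) := by
    rw [← Finset.Ico_add_one_right_eq_Icc, Finset.sum_Ico_eq_sum_range, Nat.add_sub_cancel]
    exact Finset.sum_congr rfl fun j _ => by rw [add_comm]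
  rw [approxGainCDF, Fin.sum_univ_succ]
  simp only [Fin.val_zero, Fin.val_succ]
  rw [Fin.sum_univ_eq_sum_range
    (fun j => coeffB K (j + 1) * Real.exp (-(P.coeffC K (j + 1) * t))) K]
  simp only [coeffB, coeffC, if_true, Nat.add_one_ne_zero, if_false]
  rw [zero_mul, neg_zero, Real.exp_zero, mul_one, hIcc, ← Finset.sum_neg_distrib,
    ← Finset.sum_add_distrib]
  refine Finset.sum_congr rfl fun j hj => ?_
  have hjK : (j : ℝ) + 1 ≤ K := by exact_mod_cast Finset.mem_range.1 hj
  have hKpos : (0 : ℝ) < K := by have : (0 : ℝ) ≤ j := j.cast_nonneg; linarith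
  set θ : ℝ := (2 * (j : ℝ) + 1) / (2 * K) * Real.pi with hθ
  have hθ0 : 0 ≤ θ := by have := Real.pi_pos; positivity
  have hθπ : θ ≤ Real.pi := by
    refine mul_le_of_le_one_left Real.pi_pos.le ?_
    rw [div_le_one (by positivity)]
    linarith
  have hnode : node K (j + 1) = Real.cos θ := by
    rw [node, hθ]
    congr 2
    push_cast
    ring
  have hsqrt : Real.sqrt (1 - Real.cos θ ^ 2) = Real.sin θ :=
    (Real.sin_eq_sqrt_one_sub_cos_sq hθ0 hθπ).symm
  rw [weight, hnode, hsqrt, gainKernel]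
  field_simp
  ring

lemma tendsto_approxGainCDF (t : ℝ) :
    Filter.Tendsto (fun K => P.approxGainCDF K t) Filter.atTop (nhds (P.gainCDF t)) := by
  simp_rw [approxGainCDF_eq]
  rw [← integral_gainKernel]
  exact tendsto_midpoint_sum (P.continuous_gainKernel t) Real.pi_pos

lemma tendsto_approxCDF (x : ℝ) :
    Filter.Tendsto (fun K => P.approxCDF K x) Filter.atTop
      (nhds (P.orderPoly (P.gainCDF (x / (P.ρb * P.a))))) := by
  simp_rw [approxCDF_eq]
  exact (P.continuous_orderPoly.tendsto _).comp (P.tendsto_approxGainCDF _)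

lemma abs_gainKernel_le {t : ℝ} (ht : 0 ≤ t) (θ : ℝ) : |P.gainKernel t θ| ≤ 1 := by
  have h1 : 0 ≤ Real.cos θ + 1 := by linarith [Real.neg_one_le_cos θ]
  have h2 : Real.cos θ + 1 ≤ 2 := by linarith [Real.cos_le_one θ]
  have hRD := P.RD_pos
  set c : ℝ := (1 + (P.RD / 2 * (Real.cos θ + 1)) ^ P.α) * t with hc
  have hc0 : 0 ≤ c := by positivity
  have he : Real.exp (-c) ≤ 1 := Real.exp_le_one_iff.2 (by linarith)
  have he0 := Real.exp_pos (-c)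
  rw [gainKernel, abs_mul, abs_mul, abs_mul, abs_of_nonneg h1,
    abs_of_nonneg (show 0 ≤ 1 - Real.exp (-c) by linarith), abs_of_pos (by norm_num : (0 : ℝ) < 1 / 2)]
  calc 1 / 2 * |Real.sin θ| * (Real.cos θ + 1) * (1 - Real.exp (-c)) ≤ 1 / 2 * 1 * 2 * 1 := by
        have := Real.abs_sin_le_one θ
        have h3 : 1 - Real.exp (-c) ≤ 1 := by linarith
        have h4 : 0 ≤ 1 - Real.exp (-c) := by linarith
        gcongr
    _ = 1 := by norm_num

/-- The kernel is bounded by 1 and the K cells have total length π. The bound is crude, but its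
uniformity in K is all that dominated convergence needs. -/
lemma abs_approxGainCDF_le {t : ℝ} (ht : 0 ≤ t) (K : ℕ) : |P.approxGainCDF K t| ≤ Real.pi := by
  rw [approxGainCDF_eq]
  rcases Nat.eq_zero_or_pos K with rfl | hK
  · simp [Real.pi_pos.le]
  have hKpos : (0 : ℝ) < K := by exact_mod_cast hK
  calc _ ≤ ∑ j ∈ Finset.range K, Real.pi / K * 1 := by
        refine (Finset.abs_sum_le_sum_abs _ _).trans (Finset.sum_le_sum fun j _ => ?_)
        rw [abs_mul, abs_of_pos (div_pos Real.pi_pos hKpos)]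
        exact mul_le_mul_of_nonneg_left (P.abs_gainKernel_le ht _)
          (div_pos Real.pi_pos hKpos).le
    _ = Real.pi := by
        rw [Finset.sum_const, Finset.card_range, nsmul_eq_mul]; field_simp

/-- The approximate distribution functions are bounded uniformly in the number of nodes. -/
lemma exists_abs_approxCDF_le : ∃ C, ∀ K x, 0 ≤ x → |P.approxCDF K x| ≤ C := by
  obtain ⟨C, hC⟩ := (isCompact_Icc (a := -Real.pi) (b := Real.pi)).exists_bound_of_continuousOn
    P.continuous_orderPoly.continuousOn
  refine ⟨C, fun K x hx => ?_⟩
  rw [approxCDF_eq]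
  exact hC _ (abs_le.1 (P.abs_approxGainCDF_le (div_nonneg hx P.ρb_mul_a_pos.le) K))

end Params

end OrderStatistics

section Outage

namespace Params

/-! ### The legitimate users -/

section

variable {P : Params} {Ω : Type*} [MeasurableSpace Ω] {μ : Measure Ω}
  {U : Fin P.M → Ω → Plane} {H : Fin P.M → Ω → ℂ} {X : ℕ → Ω → Plane} {G : ℕ → Ω → ℂ}

lemma measurable_userGain : Measurable fun p : Plane × ℂ => P.userGain p.1 p.2 := by
  unfold userGain; fun_prop

lemma userGain_nonneg (u : Plane) (z : ℂ) : 0 ≤ P.userGain u z := by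
  unfold userGain; positivity

lemma lt_userGain_iff {t : ℝ} (u : Plane) (z : ℂ) :
    t < P.userGain u z ↔ (1 + ‖u‖ ^ P.α) * t < ‖z‖ ^ 2 := by
  rw [userGain, lt_div_iff₀ (by positivity), mul_comm]

lemma volume_disc : volume (Metric.closedBall (0 : Plane) P.RD)
    = ENNReal.ofReal (P.RD ^ 2 * Real.pi) := by
  rw [EuclideanSpace.volume_closedBall_fin_two, ← ENNReal.ofReal_pow P.RD_pos.le,
    ← ENNReal.ofReal_mul (by positivity)]

/-- Expectation of a radial function under the uniform law on the disc. -/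
lemma integral_cond_disc (f : ℝ → ℝ) :
    ∫ u, f ‖u‖ ∂(cond volume (Metric.closedBall (0 : Plane) P.RD))
      = 2 / P.RD ^ 2 * ∫ r in (0 : ℝ)..P.RD, r * f r := by
  have hRD := P.RD_pos
  have hpi := Real.pi_pos
  have h1 : ∫ u in Metric.closedBall (0 : Plane) P.RD, f ‖u‖
      = ∫ u : Plane, (fun y : ℝ => if y ≤ P.RD then f y else 0) ‖u‖ := by
    rw [← integral_indicator measurableSet_closedBall]
    refine integral_congr_ae (ae_of_all _ fun u => ?_)
    change (Metric.closedBall (0 : Plane) P.RD).indicator (fun u => f ‖u‖) u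
      = if ‖u‖ ≤ P.RD then f ‖u‖ else 0
    classical
    rw [Set.indicator_apply]
    exact if_congr mem_closedBall_zero_iff rfl rfl
  have h2 : ∫ y in Set.Ioi (0 : ℝ), y * (if y ≤ P.RD then f y else 0)
      = ∫ r in (0 : ℝ)..P.RD, r * f r := by
    rw [intervalIntegral.integral_of_le hRD.le, ← integral_indicator measurableSet_Ioi,
      ← integral_indicator measurableSet_Ioc]
    congr 1
    ext y
    simp only [Set.indicator_apply, Set.mem_Ioi, Set.mem_Ioc]
    by_cases h0 : 0 < y <;> by_cases h1 : y ≤ P.RD <;> simp [h0, h1]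
  rw [ProbabilityTheory.cond, integral_smul_measure, h1,
    integral_plane_norm (fun y : ℝ => if y ≤ P.RD then f y else 0), h2, volume_disc,
    ENNReal.toReal_inv, ENNReal.toReal_ofReal (by positivity), smul_eq_mul]
  field_simp

lemma isProbabilityMeasure_cond_disc :
    IsProbabilityMeasure (cond volume (Metric.closedBall (0 : Plane) P.RD)) := by
  have hRD := P.RD_pos
  have hpi := Real.pi_pos
  refine cond_isProbabilityMeasure_of_finite ?_ ?_ <;> rw [volume_disc]
  · simp only [ne_eq, ENNReal.ofReal_eq_zero, not_le]
    positivity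
  · exact ENNReal.ofReal_ne_top

lemma IsNetwork.measurable_user (h : P.IsNetwork μ U H X G) (i : Fin P.M) :
    Measurable fun ω => (U i ω, H i ω) := (h.measurable_U i).prodMk (h.measurable_H i)

lemma IsNetwork.measurable_gain (h : P.IsNetwork μ U H X G) (i : Fin P.M) :
    Measurable fun ω => P.userGain (U i ω) (H i ω) :=
  measurable_userGain.comp (h.measurable_user i)

lemma measurable_userSNR (hU : ∀ i, Measurable (U i)) (hH : ∀ i, Measurable (H i)) :
    Measurable (P.userSNR U H) :=
  (measurable_orderStat fun i => measurable_userGain.comp ((hU i).prodMk (hH i))).const_mul _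

lemma IsNetwork.indepFun_SNR (h : P.IsNetwork μ U H X G) :
    IndepFun (P.userSNR U H) (P.eveSNR X G) μ := by
  -- Each SNR is the same functional evaluated on the coordinate process of its own block, so
  -- independence of the blocks passes to the SNRs.
  refine h.indep_users_eves.comp
    (φ := P.userSNR (fun i (x : Fin P.M → Plane × ℂ) => (x i).1) (fun i x => (x i).2))
    (ψ := P.eveSNR (fun j (x : ℕ → Plane × ℂ) => (x j).1) (fun j x => (x j).2)) ?_ ?_
  · exact measurable_userSNR (fun i => (measurable_pi_apply i).fst)
      (fun i => (measurable_pi_apply i).snd)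
  · exact measurable_eveSNR (fun i => (measurable_pi_apply i).fst)
      (fun i => (measurable_pi_apply i).snd)

variable [IsProbabilityMeasure μ]

lemma IsNetwork.map_user (h : P.IsNetwork μ U H X G) (i : Fin P.M) :
    μ.map (fun ω => (U i ω, H i ω))
      = (cond volume (Metric.closedBall (0 : Plane) P.RD)).prod stdComplexGaussian := by
  rw [(indepFun_iff_map_prod_eq_prod_map_map (h.measurable_U i).aemeasurable
    (h.measurable_H i).aemeasurable).1 (h.indep_UH i), (h.law_H i).map_eq]
  congr 1
  exact h.law_U i

/-- Given the distance r, the gain exceeds t with probability exp(-(1 + r^α) t); the uniform law on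
the disc gives r the density 2r / R_D². -/
lemma IsNetwork.measureReal_gain_le (h : P.IsNetwork μ U H X G) (i : Fin P.M) {t : ℝ}
    (ht : 0 ≤ t) : μ.real {ω | P.userGain (U i ω) (H i ω) ≤ t} = P.gainCDF t := by
  have hRD := P.RD_pos
  have := isProbabilityMeasure_cond_disc (P := P)
  set D := cond volume (Metric.closedBall (0 : Plane) P.RD) with hD
  set f : ℝ → ℝ := fun r => Real.exp (-((1 + r ^ P.α) * t)) with hf
  have hfc : Continuous f := by
    have h := Real.continuous_rpow_const P.α_pos.le
    simp only [hf]
    fun_prop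
  set S : Set (Plane × ℂ) := {p | t < P.userGain p.1 p.2} with hS
  have hSm : MeasurableSet S := measurableSet_lt measurable_const measurable_userGain
  have htail : μ.real {ω | t < P.userGain (U i ω) (H i ω)}
      = 2 / P.RD ^ 2 * ∫ r in (0 : ℝ)..P.RD, r * f r := by
    have h1 : {ω | t < P.userGain (U i ω) (H i ω)} = (fun ω => (U i ω, H i ω)) ⁻¹' S := rfl
    have hsec : ∀ u : Plane, stdComplexGaussian (Prod.mk u ⁻¹' S) = ENNReal.ofReal (f ‖u‖) := by
      intro u
      rw [← stdComplexGaussian_tail (by positivity)]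
      congr 1
      ext z
      exact lt_userGain_iff u z
    rw [Measure.real, h1, ← Measure.map_apply (h.measurable_user i) hSm, h.map_user,
      Measure.prod_apply hSm]
    simp_rw [hsec]
    rw [← integral_cond_disc, ← integral_eq_lintegral_of_nonneg_ae
      (ae_of_all _ fun u => (Real.exp_pos _).le)
      (hfc.comp continuous_norm).aestronglyMeasurable]
  have hcompl : {ω | P.userGain (U i ω) (H i ω) ≤ t} = {ω | t < P.userGain (U i ω) (H i ω)}ᶜ := by
    ext ω; simp
  rw [hcompl, probReal_compl_eq_one_sub (measurableSet_lt measurable_const (h.measurable_gain i)),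
    htail, gainCDF]
  have hexp : ∀ r : ℝ, r * (1 - Real.exp (-((1 + r ^ P.α) * t))) = r - r * f r := by
    intro r; rw [hf]; ring
  simp_rw [hexp]
  have hrf : Continuous fun r => r * f r := by fun_prop
  rw [intervalIntegral.integral_sub (f := fun r => r) (continuous_id.intervalIntegrable _ _)
    (hrf.intervalIntegrable _ _), integral_id]
  field_simp
  ring

lemma userSNR_le_iff {Ω : Type*} {U : Fin P.M → Ω → Plane} {H : Fin P.M → Ω → ℂ} (x : ℝ) (ω : Ω) : P.userSNR U H ω ≤ x ↔
    (P.orderStat fun i => P.userGain (U i ω) (H i ω)) ≤ x / (P.ρb * P.a) := by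
  rw [userSNR, le_div_iff₀ P.ρb_mul_a_pos, mul_comm]

lemma userSNR_nonneg {Ω : Type*} {U : Fin P.M → Ω → Plane} {H : Fin P.M → Ω → ℂ} (ω : Ω) : 0 ≤ P.userSNR U H ω := by
  obtain ⟨i, hi⟩ := P.orderStat_mem_range (fun i => P.userGain (U i ω) (H i ω))
  rw [userSNR, ← hi]
  exact mul_nonneg P.ρb_mul_a_pos.le (userGain_nonneg _ _)

lemma IsNetwork.measureReal_userSNR_le (h : P.IsNetwork μ U H X G) {x : ℝ} (hx : 0 ≤ x) :
    μ.real {ω | P.userSNR U H ω ≤ x} = P.orderPoly (P.gainCDF (x / (P.ρb * P.a))) := by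
  simp_rw [userSNR_le_iff]
  refine measureReal_orderStat_le h.measurable_gain ?_
    (fun i => h.measureReal_gain_le i (div_nonneg hx P.ρb_mul_a_pos.le))
  exact h.indep_users.comp (fun _ p => P.userGain p.1 p.2) fun _ => measurable_userGain

/-- If the SNR equals x, some individual gain equals x / (ρ_b a); given that user's position, the
fading then lies on a circle, which is null. -/
lemma IsNetwork.measure_userSNR_eq (h : P.IsNetwork μ U H X G) (x : ℝ) :
    μ {ω | P.userSNR U H ω = x} = 0 := by
  have hb := P.ρb_mul_a_pos
  refine measure_mono_null (t := ⋃ i, (fun ω => (U i ω, H i ω)) ⁻¹'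
    {p | P.userGain p.1 p.2 = x / (P.ρb * P.a)}) ?_ (measure_iUnion_null fun i => ?_)
  · intro ω hω
    obtain ⟨i, hi⟩ := P.orderStat_mem_range (fun i => P.userGain (U i ω) (H i ω))
    have hω : P.userSNR U H ω = x := hω
    refine Set.mem_iUnion.2 ⟨i, ?_⟩
    change P.userGain (U i ω) (H i ω) = _
    rw [eq_div_iff hb.ne', mul_comm, ← hω, userSNR, ← hi]
  · have hSm : MeasurableSet {p : Plane × ℂ | P.userGain p.1 p.2 = x / (P.ρb * P.a)} :=
      measurableSet_eq_fun measurable_userGain measurable_const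
    rw [← Measure.map_apply (h.measurable_user i) hSm, h.map_user, Measure.prod_apply hSm]
    refine (lintegral_congr fun u => ?_).trans lintegral_zero
    rw [← stdComplexGaussian_sphere (x / (P.ρb * P.a) * (1 + ‖u‖ ^ P.α))]
    congr 1
    ext z
    change ‖z‖ ^ 2 / (1 + ‖u‖ ^ P.α) = _ ↔ ‖z‖ ^ 2 = _
    rw [div_eq_iff (by positivity)]

/-! ### The secrecy outage probability -/

lemma measurable_secrecyRate : Measurable fun p : ℝ × ENNReal => secrecyRate p.1 p.2 := by
  unfold secrecyRate Real.logb
  refine Measurable.ite (measurableSet_eq_fun measurable_snd measurable_const) measurable_const ?_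
  have h2 : Measurable fun p : ℝ × ENNReal => p.2.toReal := measurable_snd.ennreal_toReal
  fun_prop

/-- Because R > 0, the positive part does not affect the comparison with R. -/
lemma secrecyRate_ofReal_lt_iff {b x R : ℝ} (hb : 0 ≤ b) (hx : 0 ≤ x) (hR : 0 < R) :
    secrecyRate b (ENNReal.ofReal x) < R ↔ b < (2 : ℝ) ^ R * (1 + x) - 1 := by
  have h2 : (1 : ℝ) < 2 := one_lt_two
  have h1x : 0 < 1 + x := by linarith
  rw [secrecyRate, if_neg ENNReal.ofReal_ne_top, ENNReal.toReal_ofReal hx, max_lt_iff,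
    and_iff_left hR, ← Real.logb_div (by positivity) h1x.ne',
    Real.logb_lt_iff_lt_rpow h2 (by positivity), div_lt_iff₀ h1x]
  constructor <;> intro h <;> linarith

lemma nonneg_threshold {x R : ℝ} (hx : 0 ≤ x) (hR : 0 < R) : 0 ≤ (2 : ℝ) ^ R * (1 + x) - 1 := by
  have := Real.one_le_rpow one_le_two hR.le
  nlinarith

lemma integrableOn_evePDF_mul {g : ℝ → ℝ} (hg : Measurable g) {C : ℝ}
    (hC : ∀ x, 0 < x → |g x| ≤ C) : IntegrableOn (fun x => P.evePDF x * g x) (Set.Ioi 0) := by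
  refine Integrable.mul_bdd (c := C) integrableOn_evePDF hg.aestronglyMeasurable ?_
  filter_upwards [ae_restrict_mem measurableSet_Ioi] with x hx
  exact hC x hx

lemma measurable_measureReal_userSNR_le (R : ℝ) :
    Measurable fun x : ℝ => μ.real {ω | P.userSNR U H ω ≤ (2 : ℝ) ^ R * (1 + x) - 1} := by
  refine Monotone.measurable fun x y hxy => measureReal_mono fun ω hω => ?_
  have hω : P.userSNR U H ω ≤ (2 : ℝ) ^ R * (1 + x) - 1 := hω
  refine hω.trans ?_
  gcongr

lemma integrableOn_evePDF_mul_userSNR (R : ℝ) :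
    IntegrableOn (fun x => P.evePDF x *
      μ.real {ω | P.userSNR U H ω ≤ (2 : ℝ) ^ R * (1 + x) - 1}) (Set.Ioi 0) :=
  integrableOn_evePDF_mul (measurable_measureReal_userSNR_le R) (C := 1) fun x _ => by
    rw [abs_of_nonneg measureReal_nonneg]; exact measureReal_le_one

lemma IsNetwork.sop_eq (h : P.IsNetwork μ U H X G) {R : ℝ} (hR : 0 < R) :
    P.sop μ U H X G R = ∫ x in Set.Ioi (0 : ℝ), P.evePDF x *
      μ.real {ω | P.userSNR U H ω ≤ (2 : ℝ) ^ R * (1 + x) - 1} := by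
  have hB := measurable_userSNR (P := P) h.measurable_U h.measurable_H
  have hE := measurable_eveSNR (P := P) h.ppp.measurable h.measurable_G
  have := Measure.isProbabilityMeasure_map (μ := μ) hB.aemeasurable
  have := Measure.isProbabilityMeasure_map (μ := μ) hE.aemeasurable
  set S : Set (ℝ × ENNReal) := {p | secrecyRate p.1 p.2 < R} with hS
  have hSm : MeasurableSet S := measurableSet_lt measurable_secrecyRate measurable_const
  have hsec : ∀ x : ℝ, 0 < x → μ.map (P.userSNR U H) ((fun b => (b, ENNReal.ofReal x)) ⁻¹' S)
      = ENNReal.ofReal (μ.real {ω | P.userSNR U H ω ≤ (2 : ℝ) ^ R * (1 + x) - 1}) := by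
    intro x hx
    rw [Measure.map_apply hB (measurable_prodMk_right hSm), ofReal_measureReal]
    refine measure_congr ?_
    have hne : ∀ᵐ ω ∂μ, P.userSNR U H ω ≠ (2 : ℝ) ^ R * (1 + x) - 1 := by
      simpa only [ae_iff, ne_eq, not_not] using h.measure_userSNR_eq _
    filter_upwards [hne] with ω hω
    refine propext ?_
    change secrecyRate (P.userSNR U H ω) (ENNReal.ofReal x) < R ↔
      P.userSNR U H ω ≤ (2 : ℝ) ^ R * (1 + x) - 1
    rw [secrecyRate_ofReal_lt_iff (userSNR_nonneg ω) hx.le hR]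
    exact ⟨le_of_lt, fun hle => lt_of_le_of_ne hle hω⟩
  have hset : {ω | secrecyRate (P.userSNR U H ω) (P.eveSNR X G ω) < R}
      = (fun ω => (P.userSNR U H ω, P.eveSNR X G ω)) ⁻¹' S := rfl
  -- By independence the joint law is a product. Fubini with the eavesdropper as outer variable
  -- leaves the user's distribution function integrated against the density of `eveLaw`.
  rw [sop, Measure.real, hset, ← Measure.map_apply (hB.prodMk hE) hSm,
    (indepFun_iff_map_prod_eq_prod_map_map hB.aemeasurable hE.aemeasurable).1 h.indepFun_SNR,
    Measure.prod_apply_symm hSm, h.map_eveSNR,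
    lintegral_map (measurable_measure_prodMk_right hSm) ENNReal.measurable_ofReal, eveLaw,
    lintegral_withDensity_eq_lintegral_mul₀
      (integrableOn_evePDF (P := P)).aestronglyMeasurable.aemeasurable.ennreal_ofReal
      (g := fun a => μ.map (P.userSNR U H) ((fun b => (b, ENNReal.ofReal a)) ⁻¹' S))
      ((measurable_measure_prodMk_right hSm).comp ENNReal.measurable_ofReal).aemeasurable,
    integral_eq_lintegral_of_nonneg_ae]
  · congr 1
    refine setLIntegral_congr_fun measurableSet_Ioi fun x hx => ?_
    simp only [Pi.mul_apply]
    rw [hsec x hx, ENNReal.ofReal_mul (evePDF_nonneg hx)]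
  · filter_upwards [ae_restrict_mem measurableSet_Ioi] with x hx
    exact mul_nonneg (evePDF_nonneg hx) measureReal_nonneg
  · exact (integrableOn_evePDF_mul_userSNR R).aestronglyMeasurable

end

/-! ### The closed form -/

variable (P : Params)

lemma node_add_one_nonneg (K k : ℕ) : 0 ≤ node K k + 1 := by
  have := Real.neg_one_le_cos ((2 * (k : ℝ) - 1) / (2 * (K : ℝ)) * Real.pi)
  rw [node]; linarith

lemma coeffC_nonneg (K k : ℕ) : 0 ≤ P.coeffC K k := by
  have := P.RD_pos
  have := node_add_one_nonneg K k
  rw [coeffC]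
  split_ifs <;> positivity

lemma sopIntegrand_eq (K : ℕ) (q : Fin (K + 1) → ℕ) (R x : ℝ) :
    P.sopIntegrand K q R x = P.evePDF x * Real.exp (-∑ k : Fin (K + 1),
      (q k : ℝ) * P.coeffC K k * (((2 : ℝ) ^ R * (1 + x) - 1) / (P.ρb * P.a))) := by
  rw [sopIntegrand, evePDF, sub_eq_add_neg, Real.exp_add]
  ring

/-- The integrand is the density times an exponential of a nonpositive quantity, as c_k ≥ 0 and the
threshold is nonnegative. -/
lemma integrableOn_sopIntegrand (K : ℕ) (q : Fin (K + 1) → ℕ) {R : ℝ} (hR : 0 < R) :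
    IntegrableOn (P.sopIntegrand K q R) (Set.Ioi 0) := by
  simp_rw [funext (P.sopIntegrand_eq K q R)]
  refine integrableOn_evePDF_mul (by fun_prop) (C := 1) fun x hx => ?_
  rw [abs_of_pos (Real.exp_pos _), Real.exp_le_one_iff, neg_nonpos]
  refine Finset.sum_nonneg fun k _ => mul_nonneg (mul_nonneg (Nat.cast_nonneg _)
    (P.coeffC_nonneg K k)) (div_nonneg (nonneg_threshold hx.le hR) P.ρb_mul_a_pos.le)

lemma measurable_approxCDF (K : ℕ) : Measurable (P.approxCDF K) := by
  unfold approxCDF; fun_prop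

lemma integrableOn_evePDF_mul_approxCDF (K : ℕ) {R : ℝ} (hR : 0 < R) :
    IntegrableOn (fun x => P.evePDF x * P.approxCDF K ((2 : ℝ) ^ R * (1 + x) - 1))
      (Set.Ioi 0) := by
  obtain ⟨C, hC⟩ := P.exists_abs_approxCDF_le
  exact integrableOn_evePDF_mul ((P.measurable_approxCDF K).comp (by fun_prop))
    fun x hx => hC K _ (nonneg_threshold hx.le hR)

lemma sopFormula_eq (K : ℕ) {R : ℝ} (hR : 0 < R) :
    P.sopFormula K R
      = ∫ x in Set.Ioi (0 : ℝ), P.evePDF x * P.approxCDF K ((2 : ℝ) ^ R * (1 + x) - 1) := by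
  have hi : ∀ q : Fin (K + 1) → ℕ, ∀ c : ℝ,
      IntegrableOn (fun x => c * P.sopIntegrand K q R x) (Set.Ioi 0) := fun q c =>
    (P.integrableOn_sopIntegrand K q hR).const_mul c
  have hpt : ∀ x, P.evePDF x * P.approxCDF K ((2 : ℝ) ^ R * (1 + x) - 1)
      = P.phi * ∑ p ∈ Finset.range (P.M - P.n + 1),
        ((P.M - P.n).choose p : ℝ) * ((-1) ^ p / ((P.n : ℝ) + p)) *
          ∑ q ∈ P.indexSet K p, ((Nat.multinomial Finset.univ q : ℝ) *
            (∏ k : Fin (K + 1), coeffB K k ^ q k)) * P.sopIntegrand K q R x := by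
    intro x
    rw [approxCDF]
    simp_rw [sopIntegrand_eq, Finset.mul_sum]
    refine Finset.sum_congr rfl fun p _ => Finset.sum_congr rfl fun q _ => ?_
    ring
  simp_rw [hpt]
  rw [integral_const_mul, integral_finsetSum _ fun p _ => (integrable_finsetSum _
    fun q _ => hi q _).const_mul _, sopFormula]
  congr 1
  refine Finset.sum_congr rfl fun p _ => ?_
  rw [integral_const_mul, integral_finsetSum _ fun q _ => hi q _]
  congr 1
  exact Finset.sum_congr rfl fun q _ => (integral_const_mul _ _).symm

/-- Dominated convergence, with a constant multiple of the eavesdropper density as dominating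
function. -/
lemma tendsto_sopFormula {R : ℝ} (hR : 0 < R) {F : ℝ → ℝ}
    (hF : ∀ x, 0 ≤ x → Filter.Tendsto (fun K => P.approxCDF K x) Filter.atTop (nhds (F x))) :
    Filter.Tendsto (fun K => P.sopFormula K R) Filter.atTop
      (nhds (∫ x in Set.Ioi (0 : ℝ), P.evePDF x * F ((2 : ℝ) ^ R * (1 + x) - 1))) := by
  obtain ⟨C, hC⟩ := P.exists_abs_approxCDF_le
  simp_rw [fun K => P.sopFormula_eq K hR]
  refine tendsto_integral_of_dominated_convergence (fun x => P.evePDF x * C)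
    (fun K => (P.integrableOn_evePDF_mul_approxCDF K hR).aestronglyMeasurable)
    (integrableOn_evePDF.mul_const C) (fun K => ?_) ?_
  · filter_upwards [ae_restrict_mem measurableSet_Ioi] with x hx
    rw [norm_mul, Real.norm_of_nonneg (evePDF_nonneg hx)]
    exact mul_le_mul_of_nonneg_left (hC K _ (nonneg_threshold (le_of_lt hx) hR)) (evePDF_nonneg hx)
  · filter_upwards [ae_restrict_mem measurableSet_Ioi] with x hx
    exact (hF _ (nonneg_threshold (le_of_lt hx) hR)).const_mul _

end Params

end Outage

end NOMA

end

theorem theorem1 {Ω : Type*} [MeasurableSpace Ω] (μ : Measure Ω) [IsProbabilityMeasure μ]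
    (P : NOMA.Params)
    (U : Fin P.M → Ω → NOMA.Plane) (H : Fin P.M → Ω → ℂ)
    (X : ℕ → Ω → NOMA.Plane) (G : ℕ → Ω → ℂ)
    (hnet : P.IsNetwork μ U H X G) (R : ℝ) (hR : 0 < R) :
    -- the law of the SNR of the most detrimental eavesdropper has density `evePDF`
    μ.map (P.eveSNR X G) =
        ((volume.restrict (Set.Ioi (0 : ℝ))).withDensity
          (fun x => ENNReal.ofReal (P.evePDF x))).map ENNReal.ofReal ∧
    -- the quadrature expression approximates the distribution function of the user's SNR
    (∀ x : ℝ, 0 ≤ x →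
      Filter.Tendsto (fun K : ℕ => P.approxCDF K x) Filter.atTop
        (nhds (μ.real {ω | P.userSNR U H ω ≤ x}))) ∧
    -- the exact outage probability combines the density and the distribution function
    IntegrableOn (fun x => P.evePDF x *
        μ.real {ω | P.userSNR U H ω ≤ (2 : ℝ) ^ R * (1 + x) - 1}) (Set.Ioi 0) ∧
    P.sop μ U H X G R = ∫ x in Set.Ioi (0 : ℝ), P.evePDF x *
        μ.real {ω | P.userSNR U H ω ≤ (2 : ℝ) ^ R * (1 + x) - 1} ∧
    -- replacing the distribution function by its approximation gives the `K`-node formula,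
    -- whose integrals converge
    (∀ K : ℕ, 1 ≤ K →
      (∀ q : Fin (K + 1) → ℕ, IntegrableOn (P.sopIntegrand K q R) (Set.Ioi 0)) ∧
      IntegrableOn (fun x => P.evePDF x *
        P.approxCDF K ((2 : ℝ) ^ R * (1 + x) - 1)) (Set.Ioi 0) ∧
      P.sopFormula K R = ∫ x in Set.Ioi (0 : ℝ), P.evePDF x *
        P.approxCDF K ((2 : ℝ) ^ R * (1 + x) - 1)) ∧
    -- the formula gives the secrecy outage probability, up to a quadrature error that vanishes
    Filter.Tendsto (fun K : ℕ => P.sopFormula K R) Filter.atTop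
      (nhds (P.sop μ U H X G R)) := by
  have hcdf : ∀ x : ℝ, 0 ≤ x → Filter.Tendsto (fun K : ℕ => P.approxCDF K x) Filter.atTop
      (nhds (μ.real {ω | P.userSNR U H ω ≤ x})) := fun x hx => by
    rw [hnet.measureReal_userSNR_le hx]
    exact P.tendsto_approxCDF x
  refine ⟨hnet.map_eveSNR, hcdf, NOMA.Params.integrableOn_evePDF_mul_userSNR R, hnet.sop_eq hR,
    fun K _ => ⟨fun q => P.integrableOn_sopIntegrand K q hR,
      P.integrableOn_evePDF_mul_approxCDF K hR, P.sopFormula_eq K hR⟩, ?_⟩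
  rw [hnet.sop_eq hR]
  exact P.tendsto_sopFormula hR hcdf
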